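/- Let $G=(V,E)$ be a finite simple undirected graph. For $S\subseteq V$ and $v\in V$ let $d_S(v)$ be the number of neighbours of $v$ in $S$, and let $N(S)$ be the set of vertices outside $S$ that have a neighbour in $S$. A non-empty set $S\subseteq V$ is an offensive alliance in $G$ if $d_S(v)\ge d_{V\setminus S}(v)+1$ for all $v\in N(S)$. In the problem Offensive Alliance one is given such a graph $G$ and a positive integer $k$ (the solution size), and asks whether $G$ has an offensive alliance $S$ with $|S|\le k$. Assume the Exponential Time Hypothesis (ETH): there is a $\delta>0$ such that no algorithm decides the satisfiability of 3-CNF formulas with $n$ variables in time $2^{\delta n}\cdot |x|^{O(1)}$, where $|x|$ is the length of the input. Then Offensive Alliance cannot be solved in time $\mathcal{O}^{*}(2^{o(k\log k)})$; that is, there are no function $f:\mathbb{N}\to\mathbb{R}$ with $f(k)=o(k\log k)$ as $k\to\infty$, no polynomial $p$ and no algorithm that correctly decides every instance $x=(G,k)$ of Offensive Alliance in time at most $2^{f(k)}\cdot p(|x|)$. (Algorithms are deterministic multi-stack Turing machines; inputs are binary strings in which $G$ is given by its adjacency matrix and the parameter $k$ in unary, so that $|x|\ge k$.) -/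

import Mathlib

/-! ### Algorithms and running time

Algorithms are the multi-stack Turing machines `Turing.FinTM2`; the running time is the number of
applications of the step function until the machine halts with the answer on its output stack. -/

/-- The decision problem "given `x : α`, does `P x` hold?", whose instances are written as binary
strings by `enc`, can be solved in time `O*(T x)`: some Turing machine halts on every instance `x`
with the correct one-bit answer after at most `T x * p (|enc x|)` steps, for a polynomial `p` that
depends on the machine only. -/
def SolvableInOStar {α : Type} (enc : α → List Bool) (P : α → Prop) (T : α → ℝ) : Prop :=
  ∃ (M : Turing.TM2ComputableAux Bool Bool) (p : Polynomial ℕ), ∀ x : α, ∃ (b : Bool) (t : ℕ),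
    (b = true ↔ P x) ∧ (t : ℝ) ≤ T x * (p.eval (enc x).length : ℕ) ∧
    Nonempty (Turing.TM2OutputsInTime M.tm
      ((enc x).map M.inputAlphabet.symm) (some ([b].map M.outputAlphabet.symm)) t)

/-- The self-delimiting unary code `1…10` of a natural number. -/
def unaryCode (m : ℕ) : List Bool := List.replicate m true ++ [false]

/-! ### 3-SAT and the Exponential Time Hypothesis -/

/-- A 3-CNF formula over the variables `0, …, numVars - 1`: a list of clauses, each the disjunction
of three literals. A literal is a variable with its sign (`true` for the positive literal).
Literals may repeat within a clause, so clauses with one or two distinct literals are included. -/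
structure ThreeCNF where
  numVars : ℕ
  clauses : List (Fin 3 → Fin numVars × Bool)

namespace ThreeCNF

def Satisfiable (φ : ThreeCNF) : Prop :=
  ∃ a : Fin φ.numVars → Bool, ∀ c ∈ φ.clauses, ∃ i : Fin 3, a (c i).1 = (c i).2

/-- The number of variables in unary, followed by the literals of the clauses in order; a literal is
its sign bit followed by the unary code of its variable. -/
def encode (φ : ThreeCNF) : List Bool :=
  unaryCode φ.numVars ++
    φ.clauses.flatMap fun c => (List.finRange 3).flatMap fun i =>
      (c i).2 :: unaryCode ((c i).1 : ℕ)

end ThreeCNF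

/-- The Exponential Time Hypothesis: there is a `δ > 0` such that 3-SAT on formulas with `n`
variables cannot be solved in time `O*(2 ^ (δ n))`. -/
def ExponentialTimeHypothesis : Prop :=
  ∃ δ : ℝ, 0 < δ ∧
    ¬ SolvableInOStar ThreeCNF.encode ThreeCNF.Satisfiable
      (fun φ => (2 : ℝ) ^ (δ * (φ.numVars : ℝ)))

/-! ### Offensive alliances -/

namespace SimpleGraph

variable {V : Type*} [Fintype V] [DecidableEq V]

open Classical in
/-- `d_S(v)`: the number of neighbours of `v` in `S`. -/
noncomputable def degreeIn (G : SimpleGraph V) (S : Finset V) (v : V) : ℕ :=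
  (S.filter fun u => G.Adj v u).card

/-- `N(S)`: the vertices outside `S` that have a neighbour in `S`. -/
def openNeighborSet (G : SimpleGraph V) (S : Finset V) : Set V :=
  {v | v ∉ S ∧ ∃ u ∈ S, G.Adj u v}

/-- A nonempty set `S` with `d_S(v) ≥ d_{Sᶜ}(v) + 1` for all `v ∈ N(S)`. -/
def IsOffensiveAlliance (G : SimpleGraph V) (S : Finset V) : Prop :=
  S.Nonempty ∧ ∀ v ∈ G.openNeighborSet S, G.degreeIn S v ≥ G.degreeIn Sᶜ v + 1

end SimpleGraph

/-- An instance of Offensive Alliance: a finite simple graph, with vertices named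
`0, …, numVertices - 1`, and a positive integer `k`, the solution size. -/
structure OffensiveAllianceInstance where
  numVertices : ℕ
  graph : SimpleGraph (Fin numVertices)
  k : ℕ
  k_pos : 1 ≤ k

namespace OffensiveAllianceInstance

/-- The question: is there an offensive alliance of size at most `k`? -/
def IsYes (I : OffensiveAllianceInstance) : Prop :=
  ∃ S : Finset (Fin I.numVertices), I.graph.IsOffensiveAlliance S ∧ S.card ≤ I.k

open Classical in
/-- The number of vertices and the parameter in unary, followed by the adjacency matrix, row by
row. -/
noncomputable def encode (I : OffensiveAllianceInstance) : List Bool :=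
  unaryCode I.numVertices ++ unaryCode I.k ++
    (List.finRange I.numVertices).flatMap fun u =>
      (List.finRange I.numVertices).map fun v => decide (I.graph.Adj u v)

end OffensiveAllianceInstance

/-!
Split the variables of a 3-CNF formula with `n` variables into `O(n / log n)` groups of about
`log₄ n` variables, so that a group has only about `√n` assignments. The formula is satisfiable iff
one can choose one candidate (an assignment) from each group so that every clause contains a literal
that is made true by the candidate chosen from the group of its variable.

This selection problem is encoded by a set system: together with a core that every solution
contains, each set consists of a part of the same size as the core, so that the solution contains
more than half of the set iff it contains one more element, from that part. For the groups the parts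
are all their candidates, and for the clauses the candidates that make them true. The offensive
alliances with at most `k` elements in the incidence graph of the system, with many copies of
each set, are the sets of elements that contain more than half of each set they meet. Here `k` is
the size of the core plus the number of groups, which is `O(n / log n)`, so `k log k = O(n)` and an
algorithm running in time `O*(2 ^ o(k log k))` would decide 3-SAT in time `O*(2 ^ (δ n))` for
every `δ > 0`.

The reduction is computed by structured programs on stacks, which can be compiled to code that runs
ahead of a given multi-stack Turing machine.
-/

open Function (update)
open StateTransition (EvalsTo EvalsToInTime)
open Turing

/-! ### A structured language for stack machines -/

/-- Structured programs acting on stacks of bits indexed by `ℕ`; they stand between the reduction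
and the Turing machine that computes it. The program `ifPop k B` pops stack `k` and runs `B o` on
the result `o`, which is `none` if the stack was empty; `loop k B` pops stack `k` until it is empty
and runs `B a` after popping the bit `a`. -/
inductive StackProg : Type
  | skip : StackProg
  | push (k : ℕ) (a : Bool) : StackProg
  | seq (P Q : StackProg) : StackProg
  | ifPop (k : ℕ) (B : Option Bool → StackProg) : StackProg
  | loop (k : ℕ) (B : Bool → StackProg) : StackProg

namespace StackProg

/-- `Exec P s t s'`: started with the stacks `s`, the program `P` ends with the stacks `s'` after at
most `t` steps of the code it is compiled to. -/
inductive Exec : StackProg → (ℕ → List Bool) → ℕ → (ℕ → List Bool) → Prop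
  | skip (s) : Exec skip s 1 s
  | push (k a s) : Exec (push k a) s 1 (update s k (a :: s k))
  | seq {P Q s t s' t' s''} : Exec P s t s' → Exec Q s' t' s'' → Exec (seq P Q) s (t + t') s''
  | ifPop {k B s t s'} : Exec (B (s k).head?) (update s k (s k).tail) t s' →
      Exec (ifPop k B) s (t + 1) s'
  | loop_nil {k B s} : s k = [] → Exec (loop k B) s 1 s
  | loop_cons {k B s t s' t' s'' a l} : s k = a :: l → Exec (B a) (update s k l) t s' →
      Exec (loop k B) s' t' s'' → Exec (loop k B) s (t + t' + 1) s''
  | mono {P s t t' s'} : Exec P s t s' → t ≤ t' → Exec P s t' s'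

theorem Exec.congr {P : StackProg} {s s' s'' : ℕ → List Bool} {t t' : ℕ} (h : Exec P s t s')
    (ht : t ≤ t') (hs : s' = s'') : Exec P s t' s'' :=
  hs ▸ h.mono ht

/-- The largest index of a stack that occurs in a program. -/
def maxStack : StackProg → ℕ
  | skip => 0
  | push k _ => k
  | seq P Q => max P.maxStack Q.maxStack
  | ifPop k B => max k (Finset.univ.sup fun o => (B o).maxStack)
  | loop k B => max k (Finset.univ.sup fun a => (B a).maxStack)

/-! ### Compilation to Turing machines -/

/-- The labels of the code of a program; at the label `none` of an `ifPop` or a `loop` its stack is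
popped. -/
def Label : StackProg → Type
  | skip => Unit
  | push _ _ => Unit
  | seq P Q => P.Label ⊕ Q.Label
  | ifPop _ B => Option (Σ o, (B o).Label)
  | loop _ B => Option (Σ a, (B a).Label)

instance finite_label (P : StackProg) : Finite P.Label := by
  induction P with
  | skip | push => exact inferInstanceAs (Finite Unit)
  | seq P Q => exact inferInstanceAs (Finite (P.Label ⊕ Q.Label))
  | ifPop _ B => exact inferInstanceAs (Finite (Option (Σ o, (B o).Label)))
  | loop _ B => exact inferInstanceAs (Finite (Option (Σ a, (B a).Label)))

/-- The label at which the code of a program starts. -/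
def entry : (P : StackProg) → P.Label
  | skip => ()
  | push _ _ => ()
  | seq P _ => .inl P.entry
  | ifPop _ _ => none
  | loop _ _ => none

theorem evalsToInTime_one {σ : Type*} {f : σ → Option σ} {a b : σ} (h : f a = some b) :
    Nonempty (EvalsToInTime f a (some b) 1) :=
  ⟨⟨⟨1, h⟩, le_rfl⟩⟩

theorem evalsToInTime_map {σ τ : Type*} {f : σ → Option σ} {g : τ → Option τ} {φ : σ → τ}
    (hφ : ∀ a b, f a = some b → g (φ a) = some (φ b)) {a b : σ} {t : ℕ}
    (h : Nonempty (EvalsToInTime f a (some b) t)) :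
    Nonempty (EvalsToInTime g (φ a) (some (φ b)) t) := by
  obtain ⟨⟨⟨n, hn⟩, hnt⟩⟩ := h
  refine ⟨⟨⟨n, ?_⟩, hnt⟩⟩
  clear hnt
  induction n generalizing b with
  | zero => exact congrArg (Option.map φ) hn
  | succ n ih =>
    rw [Function.iterate_succ_apply'] at hn ⊢
    obtain ⟨c, hc, hcb⟩ := Option.bind_eq_some_iff.1 hn
    rw [ih hc]
    exact hφ c b hcb

section Prepend

variable (m : ℕ) (M : TM2ComputableAux Bool Bool)

/-- The stack alphabets of `prepend m M P`, which has the stacks `0, …, m + 1` of `P` and those of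
`M`. -/
abbrev PrependΓ : Fin (m + 2) ⊕ M.tm.K → Type
  | Sum.inl _ => Bool
  | Sum.inr k => M.tm.Γ k

/-- The internal states of `prepend m M P`: a register for the bit popped last, and a state of
`M`. -/
abbrev PrependState : Type := Option Bool × M.tm.σ

/-- The labels of `prepend m M P`: those of `P`, the label `inl none` of the transfer loop, and
those of `M`. -/
abbrev PrependLabel (P : StackProg) : Type := Option P.Label ⊕ M.tm.Λ

/-- The statements of `prepend m M P` over the labels `L`. -/
abbrev PrependStmt (L : Type) : Type := TM2.Stmt (PrependΓ m M) L (PrependState M)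

variable {m M} {L : Type}

/-- Pop stack `k` into the register and continue at a label that depends on the result. -/
def popGoto (k : ℕ) (next : Option Bool → L) : PrependStmt m M L :=
  .pop (Sum.inl (Fin.ofNat (m + 2) k)) (fun v o => (o, v.2)) (.goto fun v => next v.1)

/-- The code of a program, with its labels embedded into `L` by `emb`; the program is left to the
label `exit`. -/
def compile : (P : StackProg) → (P.Label → L) → L → P.Label → PrependStmt m M L
  | skip, _, exit => fun _ => .goto fun _ => exit
  | push k a, _, exit => fun _ =>
      .push (Sum.inl (Fin.ofNat (m + 2) k)) (fun _ => a) (.goto fun _ => exit)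
  | seq P Q, emb, exit =>
      Sum.elim (compile P (fun l => emb (.inl l)) (emb (.inr Q.entry)))
        (compile Q (fun l => emb (.inr l)) exit)
  | ifPop k B, emb, exit => fun l => l.elim
      (popGoto k fun o => emb (some ⟨o, (B o).entry⟩))
      fun l => compile (B l.1) (fun l' => emb (some ⟨l.1, l'⟩)) exit l.2
  | loop k B, emb, exit => fun l => l.elim
      (popGoto k fun o => o.elim exit fun a => emb (some ⟨a, (B a).entry⟩))
      fun l => compile (B l.1) (fun l' => emb (some ⟨l.1, l'⟩)) (emb none) l.2

/-- The stacks `s` of a program and `S` of `M`, as the stacks of `prepend m M P`. -/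
def joinStacks (s : ℕ → List Bool) (S : ∀ k, List (M.tm.Γ k)) : ∀ k, List (PrependΓ m M k)
  | Sum.inl i => s i
  | Sum.inr k => S k

theorem joinStacks_inl {k : ℕ} (hk : k ≤ m + 1) (s : ℕ → List Bool)
    (S : ∀ k, List (M.tm.Γ k)) :
    joinStacks (m := m) s S (Sum.inl (Fin.ofNat (m + 2) k)) = s k :=
  congrArg s (Nat.mod_eq_of_lt (by omega))

theorem update_joinStacks_inl {k : ℕ} (hk : k ≤ m + 1) (s : ℕ → List Bool)
    (S : ∀ k, List (M.tm.Γ k)) (l : List Bool) :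
    update (joinStacks (m := m) s S) (Sum.inl (Fin.ofNat (m + 2) k)) l =
      joinStacks (update s k l) S := by
  have hval : ((Fin.ofNat (m + 2) k : Fin (m + 2)) : ℕ) = k := Nat.mod_eq_of_lt (by omega)
  refine Function.update_eq_iff.2 ⟨?_, ?_⟩
  · simp only [joinStacks, hval, Function.update_self]
  · rintro (i | i) hi
    · have : (i : ℕ) ≠ k := fun h => hi (congrArg Sum.inl (Fin.ext (h.trans hval.symm)))
      simp only [joinStacks, Function.update_of_ne this]
    · rfl

theorem update_joinStacks_inr (s : ℕ → List Bool) (S : ∀ k, List (M.tm.Γ k)) (k : M.tm.K)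
    (l : List (M.tm.Γ k)) :
    update (joinStacks (m := m) s S) (Sum.inr k) l = joinStacks s (update S k l) := by
  refine Function.update_eq_iff.2 ⟨?_, ?_⟩
  · exact (Function.update_self k l S).symm
  · rintro (i | i) hi
    · rfl
    · exact (Function.update_of_ne (fun h => hi (congrArg Sum.inr h)) l S).symm

theorem joinStacks_nil :
    joinStacks (m := m) (M := M) (fun _ => []) (fun _ => []) = fun _ => [] := by
  funext k
  cases k <;> rfl

/-- `Leads c t l s l' s'`: from label `l` and stacks `s`, the code `c` reaches label `l'` and stacks
`s'` in at most `t` steps, without touching the stacks and the state of `M`. -/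
def Leads (c : L → PrependStmt m M L) (t : ℕ) (l : L) (s : ℕ → List Bool) (l' : L)
    (s' : ℕ → List Bool) : Prop :=
  ∀ (r : Option Bool) (v : M.tm.σ) (S : ∀ k, List (M.tm.Γ k)), ∃ r' : Option Bool,
    Nonempty (EvalsToInTime (TM2.step c) ⟨some l, (r, v), joinStacks s S⟩
      (some ⟨some l', (r', v), joinStacks s' S⟩) t)

namespace Leads

variable {c : L → PrependStmt m M L} {s s' s'' : ℕ → List Bool} {l l' l'' : L} {t t' k : ℕ}

theorem mono (h : Leads c t l s l' s') (ht : t ≤ t') : Leads c t' l s l' s' := fun r v S =>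
  let ⟨r', ⟨e⟩⟩ := h r v S
  ⟨r', ⟨⟨e.toEvalsTo, e.steps_le_m.trans ht⟩⟩⟩

theorem trans (h : Leads c t l s l' s') (h' : Leads c t' l' s' l'' s'') :
    Leads c (t + t') l s l'' s'' := fun r v S =>
  let ⟨r', ⟨e⟩⟩ := h r v S
  let ⟨r'', ⟨e'⟩⟩ := h' r' v S
  ⟨r'', ⟨Nat.add_comm t' t ▸ e.trans _ _ _ _ _ _ e'⟩⟩

theorem goto (hl : c l = .goto fun _ => l') (s : ℕ → List Bool) : Leads c 1 l s l' s :=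
  fun r _ _ => ⟨r, evalsToInTime_one (by rw [TM2.step, hl]; rfl)⟩

theorem push {a : Bool} (hk : k ≤ m + 1)
    (hl : c l = .push (Sum.inl (Fin.ofNat (m + 2) k)) (fun _ => a) (.goto fun _ => l'))
    (s : ℕ → List Bool) : Leads c 1 l s l' (update s k (a :: s k)) := fun r v S =>
  ⟨r, evalsToInTime_one (by
    rw [TM2.step, hl, TM2.stepAux, joinStacks_inl hk, update_joinStacks_inl hk, TM2.stepAux])⟩

theorem popGoto {next : Option Bool → L} (hk : k ≤ m + 1) (hl : c l = popGoto k next)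
    (s : ℕ → List Bool) : Leads c 1 l s (next (s k).head?) (update s k (s k).tail) := fun r v S =>
  ⟨(s k).head?, evalsToInTime_one (by
    rw [TM2.step, hl, StackProg.popGoto, TM2.stepAux, joinStacks_inl hk, update_joinStacks_inl hk,
      TM2.stepAux])⟩

end Leads

theorem maxStack_ifPop_le {k n : ℕ} {B : Option Bool → StackProg} :
    (ifPop k B).maxStack ≤ n ↔ k ≤ n ∧ ∀ o, (B o).maxStack ≤ n := by
  simp only [maxStack, max_le_iff, Finset.sup_le_iff, Finset.mem_univ, forall_const]

theorem maxStack_loop_le {k n : ℕ} {B : Bool → StackProg} :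
    (loop k B).maxStack ≤ n ↔ k ≤ n ∧ ∀ a, (B a).maxStack ≤ n := by
  simp only [maxStack, max_le_iff, Finset.sup_le_iff, Finset.mem_univ, forall_const]

theorem Exec.leads {P : StackProg} {s s' : ℕ → List Bool} {t : ℕ} (h : Exec P s t s')
    {c : L → PrependStmt m M L} {emb : P.Label → L} {exit : L}
    (hc : ∀ l, c (emb l) = compile P emb exit l) (hm : P.maxStack ≤ m + 1) :
    Leads c t (emb P.entry) s exit s' := by
  induction h generalizing exit with
  | skip s => exact .goto (hc _) s
  | push k a s => exact .push hm (hc _) s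
  | seq _ _ ihP ihQ =>
    obtain ⟨hP, hQ⟩ := max_le_iff.1 hm
    exact (ihP (fun l => hc (.inl l)) hP).trans (ihQ (fun l => hc (.inr l)) hQ)
  | @ifPop k B s t s' _ ih =>
    obtain ⟨hk, hB⟩ := maxStack_ifPop_le.1 hm
    have hpop := Leads.popGoto (next := fun o => emb (some ⟨o, (B o).entry⟩)) hk (hc none) s
    exact (hpop.trans (ih (fun l => hc (some ⟨_, l⟩)) (hB _))).mono (Nat.add_comm 1 t).le
  | @loop_nil k B s hs =>
    have hpop := Leads.popGoto (next := fun o => o.elim exit fun a => emb (some ⟨a, (B a).entry⟩))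
      (maxStack_loop_le.1 hm).1 (hc none) s
    rwa [hs, List.tail_nil, ← hs, Function.update_eq_self, hs] at hpop
  | @loop_cons k B s t s' t' s'' a l hs _ _ ihB ihLoop =>
    obtain ⟨hk, hB⟩ := maxStack_loop_le.1 hm
    have hpop := Leads.popGoto (next := fun o => o.elim exit fun a => emb (some ⟨a, (B a).entry⟩))
      hk (hc none) s
    rw [hs] at hpop
    exact ((hpop.trans (ihB (fun l => hc (some ⟨a, l⟩)) (hB a))).trans (ihLoop hc hm)).mono
      (by omega)
  | mono _ hle ih => exact (ih hc hm).mono hle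

/-- The statements of `M` as statements of `prepend m M P`. -/
def liftStmt (emb : M.tm.Λ → L) : TM2.Stmt M.tm.Γ M.tm.Λ M.tm.σ → PrependStmt m M L
  | .push k f q => .push (Sum.inr k) (fun v => f v.2) (liftStmt emb q)
  | .peek k f q => .peek (Sum.inr k) (fun v o => (v.1, f v.2 o)) (liftStmt emb q)
  | .pop k f q => .pop (Sum.inr k) (fun v o => (v.1, f v.2 o)) (liftStmt emb q)
  | .load f q => .load (fun v => (v.1, f v.2)) (liftStmt emb q)
  | .branch f q₁ q₂ => .branch (fun v => f v.2) (liftStmt emb q₁) (liftStmt emb q₂)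
  | .goto f => .goto fun v => emb (f v.2)
  | .halt => .halt

/-- The configurations of `M` as configurations of `prepend m M P`, in which the register and the
stacks of `P` are empty. -/
def liftCfg (emb : M.tm.Λ → L) (C : TM2.Cfg M.tm.Γ M.tm.Λ M.tm.σ) :
    TM2.Cfg (PrependΓ m M) L (PrependState M) :=
  ⟨C.l.map emb, (none, C.var), joinStacks (fun _ => []) C.stk⟩

theorem stepAux_liftStmt (emb : M.tm.Λ → L) (q : TM2.Stmt M.tm.Γ M.tm.Λ M.tm.σ) (v : M.tm.σ)
    (S : ∀ k, List (M.tm.Γ k)) :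
    TM2.stepAux (liftStmt (m := m) emb q) (none, v) (joinStacks (fun _ => []) S) =
      liftCfg emb (TM2.stepAux q v S) := by
  induction q generalizing v S with
  | push _ _ _ ih | pop _ _ _ ih =>
    rw [liftStmt, TM2.stepAux, TM2.stepAux, update_joinStacks_inr]
    exact ih _ _
  | peek _ _ _ ih | load _ _ ih => exact ih _ _
  | branch f q₁ q₂ ih₁ ih₂ =>
    rw [liftStmt, TM2.stepAux, TM2.stepAux]
    cases f v
    exacts [ih₂ v S, ih₁ v S]
  | goto f | halt => rfl

variable (m M)

/-- The code of `prepend m M P`. -/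
def prependCode (P : StackProg) : PrependLabel M P → PrependStmt m M (PrependLabel M P)
  | Sum.inl (some l) => compile P (fun l => Sum.inl (some l)) (Sum.inl none) l
  | Sum.inl none =>
      .pop (Sum.inl (Fin.ofNat (m + 2) 1)) (fun v o => (o, v.2))
        (.branch (fun v => v.1 == none) (.goto fun _ => Sum.inr M.tm.main)
          (.push (Sum.inr M.tm.k₀) (fun v => M.inputAlphabet.symm (v.1.getD false))
            (.goto fun _ => Sum.inl none)))
  | Sum.inr l => liftStmt Sum.inr (M.tm.m l)

/-- The machine that runs the program `P`, moves the contents of stack `1` onto the input stack of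
`M`, which reverses them, and then runs `M`. -/
noncomputable def prepend (P : StackProg) : TM2ComputableAux Bool Bool where
  tm :=
    { K := Fin (m + 2) ⊕ M.tm.K
      kDecidableEq := @instDecidableEqSum _ _ _ M.tm.kDecidableEq
      kFin := @instFintypeSum _ _ _ M.tm.kFin
      k₀ := Sum.inl 0
      k₁ := Sum.inr M.tm.k₁
      Γ := PrependΓ m M
      Λ := PrependLabel M P
      main := Sum.inl (some P.entry)
      ΛFin := by
        haveI := M.tm.ΛFin
        exact Fintype.ofFinite _
      σ := PrependState M
      initialState := (none, M.tm.initialState)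
      σFin := by
        haveI := M.tm.σFin
        exact inferInstance
      Γk₀Fin := inferInstanceAs (Fintype Bool)
      m := prependCode m M P }
  inputAlphabet := Equiv.refl Bool
  outputAlphabet := M.outputAlphabet

variable {m M}

theorem transfer_evalsToInTime (P : StackProg) (r : Option Bool) (v : M.tm.σ) (l : List Bool)
    (S : ∀ k, List (M.tm.Γ k)) :
    Nonempty (EvalsToInTime (TM2.step (prependCode m M P))
      ⟨some (Sum.inl none), (r, v), joinStacks (update (fun _ => []) 1 l) S⟩
      (some ⟨some (Sum.inr M.tm.main), (none, v), joinStacks (fun _ => [])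
        (update S M.tm.k₀ ((l.map M.inputAlphabet.symm).reverse ++ S M.tm.k₀))⟩)
      (l.length + 1)) := by
  induction l generalizing r S with
  | nil =>
    refine evalsToInTime_one ?_
    rw [TM2.step, prependCode, TM2.stepAux, joinStacks_inl (by omega),
      update_joinStacks_inl (by omega)]
    simp
  | cons a l ih =>
    obtain ⟨e⟩ := ih (some a) (update S M.tm.k₀ (M.inputAlphabet.symm a :: S M.tm.k₀))
    rw [Function.update_self, Function.update_idem] at e
    rw [List.map_cons, List.reverse_cons, List.append_assoc, List.singleton_append]
    refine (evalsToInTime_one ?_).map fun e₀ => e₀.trans _ _ _ _ _ _ e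
    rw [TM2.step, prependCode, TM2.stepAux, joinStacks_inl (by omega),
      update_joinStacks_inl (by omega)]
    simp only [Function.update_self, Function.update_idem, List.head?_cons, List.tail_cons]
    rw [TM2.stepAux]
    simp only [TM2.stepAux, Option.getD_some, update_joinStacks_inr]
    rfl

theorem initList_stk (tm : FinTM2) (l : List (tm.Γ tm.k₀)) :
    (initList tm l).stk = update (fun _ => []) tm.k₀ l := by
  funext k
  by_cases h : k = tm.k₀
  · subst h
    simp [initList]
  · simp [initList, h]

theorem haltList_stk (tm : FinTM2) (l : List (tm.Γ tm.k₁)) :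
    (haltList tm l).stk = update (fun _ => []) tm.k₁ l := by
  funext k
  by_cases h : k = tm.k₁
  · subst h
    simp [haltList]
  · simp [haltList, h]

theorem initList_prepend (P : StackProg) (x : List Bool) :
    initList (prepend m M P).tm x =
      (⟨some (Sum.inl (some P.entry)), (none, M.tm.initialState),
        joinStacks (update (fun _ => []) 0 x) (fun _ => [])⟩ :
        TM2.Cfg (PrependΓ m M) (PrependLabel M P) (PrependState M)) := by
  refine congrArg (TM2.Cfg.mk _ _) ((initList_stk (prepend m M P).tm x).trans ?_)
  refine Eq.trans ?_ (update_joinStacks_inl (m := m) (M := M) (k := 0) (by omega) _ _ _)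
  rw [joinStacks_nil]
  rfl

theorem haltList_prepend (P : StackProg) (z : List (M.tm.Γ M.tm.k₁)) :
    haltList (prepend m M P).tm z =
      (liftCfg Sum.inr (haltList M.tm z) :
        TM2.Cfg (PrependΓ m M) (PrependLabel M P) (PrependState M)) := by
  refine congrArg (TM2.Cfg.mk _ _) ((haltList_stk (prepend m M P).tm z).trans ?_)
  refine Eq.trans ?_ (congrArg (joinStacks fun _ => []) (haltList_stk M.tm z)).symm
  rw [← update_joinStacks_inr, joinStacks_nil]
  rfl

theorem lift_outputs (P : StackProg) {y : List (M.tm.Γ M.tm.k₀)} {z : List (M.tm.Γ M.tm.k₁)}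
    {t : ℕ} (hM : Nonempty (TM2OutputsInTime M.tm y (some z) t)) :
    Nonempty (EvalsToInTime (TM2.step (prependCode m M P))
      ⟨some (Sum.inr M.tm.main), (none, M.tm.initialState), joinStacks (fun _ => [])
        (update (fun _ => []) M.tm.k₀ y)⟩
      (some (haltList (prepend m M P).tm z)) t) := by
  rw [haltList_prepend, ← initList_stk]
  refine evalsToInTime_map (f := TM2.step M.tm.m) (φ := liftCfg Sum.inr) ?_ hM
  rintro ⟨_ | l, v, S⟩ b hb
  · cases hb
  · rw [TM2.step] at hb
    rw [← Option.some.inj hb]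
    exact congrArg some (stepAux_liftStmt Sum.inr _ v S)

/-- Since the transfer reverses the output of the program, `P` has to produce `y` with its last bit
on top. -/
theorem prepend_outputs {P : StackProg} (hP : P.maxStack ≤ m + 1) {x y : List Bool} {t t' : ℕ}
    (h : Exec P (update (fun _ => []) 0 x) t (update (fun _ => []) 1 y.reverse))
    {z : List (M.tm.Γ M.tm.k₁)}
    (hM : Nonempty (TM2OutputsInTime M.tm (y.map M.inputAlphabet.symm) (some z) t')) :
    Nonempty (TM2OutputsInTime (prepend m M P).tm x (some z) (t + (y.length + 1) + t')) := by
  obtain ⟨r, ⟨program⟩⟩ := h.leads (c := prependCode m M P) (emb := fun l => Sum.inl (some l))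
    (fun _ => rfl) hP none M.tm.initialState fun _ => []
  obtain ⟨transfer⟩ := transfer_evalsToInTime (m := m) P r M.tm.initialState y.reverse fun _ => []
  obtain ⟨machine⟩ := lift_outputs (m := m) P hM
  rw [List.map_reverse, List.reverse_reverse, List.append_nil, List.length_reverse] at transfer
  have total := (program.trans _ _ _ _ _ _ transfer).trans _ _ _ _ _ _ machine
  rw [← initList_prepend, Nat.add_comm (y.length + 1) t, Nat.add_comm t'] at total
  exact ⟨total⟩

end Prepend

/-! ### Basic programs -/

/-- The unary representation of a number on a stack. -/
abbrev num (n : ℕ) : List Bool := List.replicate n true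

/-- The program that moves the contents of stack `a` onto stack `b`, which reverses them. -/
def move (a b : ℕ) : StackProg := loop a fun c => push b c

/-- The program that empties stack `a`. -/
def clear (a : ℕ) : StackProg := loop a fun _ => skip

/-- The program that pushes the length of stack `a`, in unary, onto stack `b`; the stack `c` has to
be empty and serves to restore stack `a`. -/
def copyLen (a b c : ℕ) : StackProg :=
  seq (loop a fun x => seq (push c x) (push b true)) (move c a)

theorem exec_move {a b : ℕ} (hab : a ≠ b) {l : List Bool} {s : ℕ → List Bool} (hs : s a = l) :
    Exec (move a b) s (2 * l.length + 1) (update (update s a []) b (l.reverse ++ s b)) := by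
  induction l generalizing s with
  | nil =>
    refine (Exec.loop_nil hs).congr (by simp) ?_
    funext j
    simp only [Function.update_apply]
    split_ifs <;> simp_all
  | cons c l ih =>
    have rest := ih (s := update (update s a l) b (c :: s b)) (by simp [hab])
    refine (Exec.loop_cons (t := 1) hs ((Exec.push b c _).congr le_rfl ?_) rest).congr ?_ ?_
    · simp [hab.symm]
    · rw [List.length_cons]
      omega
    · funext j
      simp only [Function.update_apply]
      split_ifs <;> simp_all

theorem exec_clear {a : ℕ} {l : List Bool} {s : ℕ → List Bool} (hs : s a = l) :
    Exec (clear a) s (2 * l.length + 1) (update s a []) := by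
  induction l generalizing s with
  | nil => exact (Exec.loop_nil hs).congr (by simp) (by rw [← hs, Function.update_eq_self])
  | cons c l ih =>
    have rest := ih (s := update s a l) (by simp)
    refine (Exec.loop_cons hs (Exec.skip _) rest).congr ?_ (by simp)
    rw [List.length_cons]
    omega

theorem exec_copyLen_loop {a b c : ℕ} (hab : a ≠ b) (hac : a ≠ c) (hbc : b ≠ c) {l : List Bool}
    {s : ℕ → List Bool} (hs : s a = l) :
    Exec (loop a fun x => seq (push c x) (push b true)) s (3 * l.length + 1)
      (update (update (update s a []) b (num l.length ++ s b)) c (l.reverse ++ s c)) := by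
  induction l generalizing s with
  | nil =>
    refine (Exec.loop_nil hs).congr (by simp) ?_
    funext j
    simp only [Function.update_apply]
    split_ifs <;> simp_all
  | cons x l ih =>
    have rest := ih (s := update (update (update s a l) c (x :: s c)) b (true :: s b))
      (by simp [hab, hac])
    refine (Exec.loop_cons (t := 2) hs
      (((Exec.push c x _).seq (Exec.push b true _)).congr le_rfl ?_) rest).congr ?_ ?_
    · simp [hac.symm, hab.symm, hbc]
    · rw [List.length_cons]
      omega
    · funext j
      simp only [Function.update_apply]
      split_ifs <;> simp_all [List.replicate_succ']

theorem exec_copyLen {a b c : ℕ} (hab : a ≠ b) (hac : a ≠ c) (hbc : b ≠ c) {s : ℕ → List Bool}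
    (hc : s c = []) :
    Exec (copyLen a b c) s (5 * (s a).length + 2) (update s b (num (s a).length ++ s b)) := by
  refine ((exec_copyLen_loop hab hac hbc rfl).seq (exec_move hac.symm rfl)).congr ?_ ?_
  · simp only [hc, List.append_nil, Function.update_self, List.length_reverse]
    omega
  · funext j
    simp only [Function.update_apply]
    split_ifs <;> simp_all

/-! ### Functions computed by stack programs in polynomial time -/

theorem eval_monotone (q : Polynomial ℕ) : Monotone fun a => q.eval a := fun a b h => by
  simp only [Polynomial.eval_eq_sum]
  exact Finset.sum_le_sum fun i _ => Nat.mul_le_mul_left _ (Nat.pow_le_pow_left h i)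

section Ready

variable {n : ℕ} {x : List Bool} {ρ : Fin n → ℕ} {r : Fin n → ℕ} {d t : ℕ} {s : ℕ → List Bool}

/-- The stacks `s` are laid out for a program that computes from the input `x` on stack `0` and
the numbers `ρ i` on the registers `r i`, pushes its result onto the target stack `t`, and may use
the stacks from `d` on, which are empty, as scratch space. -/
structure Ready (x : List Bool) (ρ : Fin n → ℕ) (r : Fin n → ℕ) (d t : ℕ) (s : ℕ → List Bool) :
    Prop where
  target_lt : t < d
  target_ne_zero : t ≠ 0
  reg_lt : ∀ i, r i < d
  reg_ne : ∀ i, r i ≠ t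
  input : s 0 = x
  reg : ∀ i, s (r i) = num (ρ i)
  free : ∀ j, d ≤ j → s j = []

namespace Ready

theorem free_pos (h : Ready x ρ r d t s) : 0 < d := (Nat.zero_le t).trans_lt h.target_lt

theorem update_target (h : Ready x ρ r d t s) (l : List Bool) :
    Ready x ρ r d t (update s t l) where
  __ := h
  input := by rw [Function.update_of_ne h.target_ne_zero.symm, h.input]
  reg i := by rw [Function.update_of_ne (h.reg_ne i), h.reg]
  free j hj := by rw [Function.update_of_ne (by have := h.target_lt; omega), h.free j hj]

theorem update_scratch (h : Ready x ρ r d t s) (l : List Bool) :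
    Ready x ρ r (d + 1) t (update s d l) where
  target_lt := Nat.lt_succ_of_lt h.target_lt
  target_ne_zero := h.target_ne_zero
  reg_lt i := Nat.lt_succ_of_lt (h.reg_lt i)
  reg_ne := h.reg_ne
  input := by rw [Function.update_of_ne h.free_pos.ne, h.input]
  reg i := by rw [Function.update_of_ne (h.reg_lt i).ne, h.reg]
  free j hj := by rw [Function.update_of_ne (by omega), h.free j (by omega)]

theorem bind (h : Ready x ρ r d t s) (a : ℕ) :
    Ready x (Fin.cons a ρ : Fin (n + 1) → ℕ) (Fin.cons d r : Fin (n + 1) → ℕ) (d + 1) t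
      (update s d (num a)) where
  __ := h.update_scratch (num a)
  reg_lt := Fin.cases (Nat.lt_succ_self d) fun i => Nat.lt_succ_of_lt (h.reg_lt i)
  reg_ne := Fin.cases h.target_lt.ne' h.reg_ne
  reg := Fin.cases (Function.update_self ..) (h.update_scratch (num a)).reg

theorem retarget (h : Ready x ρ r d t s) : Ready x ρ r (d + 1) d s where
  target_lt := Nat.lt_succ_self d
  target_ne_zero := h.free_pos.ne'
  reg_lt i := Nat.lt_succ_of_lt (h.reg_lt i)
  reg_ne i := (h.reg_lt i).ne
  input := h.input
  reg := h.reg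
  free j hj := h.free j (by omega)

theorem exec_scratch {Q : (Fin n → ℕ) → ℕ → ℕ → StackProg} {T : ℕ} {w : List Bool}
    (h : Ready x ρ r d t s)
    (hQ : ∀ r d t s, Ready x ρ r d t s → Exec (Q r d t) s T (update s t (w ++ s t))) :
    Exec (Q r (d + 1) d) s T (update s d w) :=
  (hQ r _ d s h.retarget).congr le_rfl (by rw [h.free d le_rfl, List.append_nil])

theorem reindex {m : ℕ} {ρ r : Fin m → ℕ} (h : Ready x ρ r d t s) (f : Fin n → Fin m) :
    Ready x (ρ ∘ f) (r ∘ f) d t s where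
  __ := h
  reg_lt i := h.reg_lt (f i)
  reg_ne i := h.reg_ne (f i)
  reg i := h.reg (f i)

end Ready

end Ready

/-- `F`, a word that depends on the input and on the numbers in `n` registers, is computed by a
program in time polynomial in the length of the input and the values of the registers. The program
depends on where the stacks are placed (see `StackProg.Ready`) and leaves all stacks except the
target as they were. -/
def PolyWord {n : ℕ} (F : List Bool → (Fin n → ℕ) → List Bool) : Prop :=
  ∃ (P : (Fin n → ℕ) → ℕ → ℕ → StackProg) (q : Polynomial ℕ), ∀ x ρ B, x.length ≤ B →
    (∀ i, ρ i ≤ B) → (F x ρ).length ≤ q.eval B ∧ ∀ r d t s, Ready x ρ r d t s →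
      Exec (P r d t) s (q.eval B) (update s t (F x ρ ++ s t))

/-- `F`, a number that depends on the input and on the numbers in `n` registers, is computed in
polynomial time. -/
def PolyFn {n : ℕ} (F : List Bool → (Fin n → ℕ) → ℕ) : Prop :=
  PolyWord fun x ρ => num (F x ρ)

open Classical in
/-- The truth value of `p`, which depends on the input and on the numbers in `n` registers, is
computed in polynomial time. -/
def PolyPred {n : ℕ} (p : List Bool → (Fin n → ℕ) → Prop) : Prop :=
  PolyFn fun x ρ => if p x ρ then 1 else 0

variable {m n : ℕ}

theorem PolyWord.of_eq {F G : List Bool → (Fin n → ℕ) → List Bool} (hF : PolyWord F)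
    (h : ∀ x ρ, F x ρ = G x ρ) : PolyWord G :=
  (funext₂ h : F = G) ▸ hF

theorem PolyFn.of_eq {F G : List Bool → (Fin n → ℕ) → ℕ} (hF : PolyFn F)
    (h : ∀ x ρ, F x ρ = G x ρ) : PolyFn G :=
  (funext₂ h : F = G) ▸ hF

theorem PolyPred.of_iff {p q : List Bool → (Fin n → ℕ) → Prop} (hp : PolyPred p)
    (h : ∀ x ρ, p x ρ ↔ q x ρ) : PolyPred q :=
  (funext₂ fun x ρ => propext (h x ρ) : p = q) ▸ hp

theorem PolyFn.exists_bound {F : List Bool → (Fin n → ℕ) → ℕ} (hF : PolyFn F) :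
    ∃ q : Polynomial ℕ, ∀ x ρ B, x.length ≤ B → (∀ i, ρ i ≤ B) → F x ρ ≤ q.eval B := by
  obtain ⟨_, q, hq⟩ := hF
  exact ⟨q, fun x ρ B hx hρ => by simpa using (hq x ρ B hx hρ).1⟩

namespace PolyWord

theorem nil : PolyWord fun _ (_ : Fin n → ℕ) => [] :=
  ⟨fun _ _ _ => skip, 1, fun x ρ B _ _ => ⟨by simp, fun r d t s _ =>
    (Exec.skip s).congr (by simp) (by rw [List.nil_append, Function.update_eq_self])⟩⟩

theorem bit (b : Bool) : PolyWord fun _ (_ : Fin n → ℕ) => [b] :=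
  ⟨fun _ _ t => push t b, 1, fun x ρ B _ _ => ⟨by simp, fun r d t s _ =>
    (Exec.push t b s).congr (by simp) rfl⟩⟩

theorem append {F G : List Bool → (Fin n → ℕ) → List Bool} (hF : PolyWord F) (hG : PolyWord G) :
    PolyWord fun x ρ => F x ρ ++ G x ρ := by
  obtain ⟨P, p, hP⟩ := hF
  obtain ⟨Q, q, hQ⟩ := hG
  refine ⟨fun r d t => seq (Q r d t) (P r d t), q + p, fun x ρ B hx hρ => ?_⟩
  obtain ⟨hp, execP⟩ := hP x ρ B hx hρ
  obtain ⟨hq, execQ⟩ := hQ x ρ B hx hρ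
  rw [Polynomial.eval_add]
  refine ⟨by rw [List.length_append]; omega, fun r d t s hs => ?_⟩
  refine ((execQ r d t s hs).seq (execP r d t _ (hs.update_target _))).congr le_rfl ?_
  rw [Function.update_self, Function.update_idem, List.append_assoc]

theorem reindex {F : List Bool → (Fin m → ℕ) → List Bool} (hF : PolyWord F) (f : Fin m → Fin n) :
    PolyWord fun x ρ => F x (ρ ∘ f) := by
  obtain ⟨P, p, hP⟩ := hF
  refine ⟨fun r d t => P (r ∘ f) d t, p, fun x ρ B hx hρ => ?_⟩
  obtain ⟨hp, execP⟩ := hP x (ρ ∘ f) B hx fun i => hρ (f i)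
  exact ⟨hp, fun r d t s hs => execP _ d t s (hs.reindex f)⟩

theorem cons_le {ρ : Fin n → ℕ} {a B : ℕ} (ha : a ≤ B) (hρ : ∀ i, ρ i ≤ B) (i : Fin (n + 1)) :
    (Fin.cons a ρ : Fin (n + 1) → ℕ) i ≤ B :=
  Fin.cases ha hρ i

theorem exec_loop_flatMap {f : ℕ → List Bool} {Q : StackProg} {d t N T : ℕ} {s : ℕ → List Bool}
    (hQ : ∀ a < N, ∀ l, Exec Q (update (update s t l) d (num a)) T
      (update (update s t (f a ++ l)) d (num a)))
    (l : List Bool) :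
    Exec (loop d fun _ => Q) (update (update s t l) d (num N)) (N * (T + 1) + 1)
      (update (update s t ((List.range N).flatMap f ++ l)) d []) := by
  induction N generalizing l with
  | zero => exact (Exec.loop_nil (by simp)).congr (by simp) (by simp)
  | succ N ih =>
    have body := hQ N (Nat.lt_succ_self N) l
    have rest := ih (fun a ha => hQ a (Nat.lt_succ_of_lt ha)) (f N ++ l)
    refine (Exec.loop_cons (a := true) (l := num N) (by rw [Function.update_self]; rfl)
      (by rwa [Function.update_idem]) rest).congr (by rw [Nat.succ_mul]; omega) ?_
    rw [List.range_succ, List.flatMap_append, List.append_assoc, List.flatMap_singleton]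

/-- The counter of the loop runs downwards, and it is the register that holds the index. -/
theorem flatMap_range {F : List Bool → (Fin n → ℕ) → ℕ}
    {G : List Bool → (Fin (n + 1) → ℕ) → List Bool} (hF : PolyFn F) (hG : PolyWord G) :
    PolyWord fun x ρ => (List.range (F x ρ)).flatMap fun i => G x (Fin.cons i ρ) := by
  obtain ⟨P, p, hP⟩ := hF
  obtain ⟨Q, q, hQ⟩ := hG
  refine ⟨fun r d t => seq (P r (d + 1) d) (loop d fun _ => Q (Fin.cons d r) (d + 1) t),
    p + (p * (q.comp (Polynomial.X + p) + 1) + 1), fun x ρ B hx hρ => ?_⟩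
  obtain ⟨hp, execP⟩ := hP x ρ B hx hρ
  rw [List.length_replicate] at hp
  have hQ' : ∀ a < F x ρ, _ := fun a ha => hQ x (Fin.cons a ρ) (B + p.eval B) (by omega)
    (cons_le (by omega) fun i => (hρ i).trans (by omega))
  simp only [Polynomial.eval_add, Polynomial.eval_comp, Polynomial.eval_X, Polynomial.eval_mul,
    Polynomial.eval_one]
  constructor
  · calc ((List.range (F x ρ)).flatMap fun i => G x (Fin.cons i ρ)).length
        = ((List.range (F x ρ)).map fun i => (G x (Fin.cons i ρ)).length).sum :=
          List.length_flatMap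
      _ ≤ F x ρ * q.eval (B + p.eval B) := by
          simpa using List.sum_le_card_nsmul
            ((List.range (F x ρ)).map fun i => (G x (Fin.cons i ρ)).length) _
            (List.forall_mem_map.2 fun i hi => (hQ' i (List.mem_range.1 hi)).1)
      _ ≤ p.eval B * (q.eval (B + p.eval B) + 1) := Nat.mul_le_mul hp (Nat.le_succ _)
      _ ≤ _ := by omega
  · intro r d t s hs
    have hdt := hs.target_lt.ne'
    have looped := exec_loop_flatMap (f := fun i => G x (Fin.cons i ρ)) (s := s)
      (fun a ha l => ((hQ' a ha).2 _ _ t _ ((hs.update_target l).bind a)).congr le_rfl ?_) (s t)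
    · rw [Function.update_eq_self] at looped
      refine ((hs.exec_scratch execP).seq looped).congr ?_ ?_
      · gcongr
      · exact Function.update_eq_self_iff.2 (by rw [Function.update_of_ne hdt, hs.free d le_rfl])
    · rw [Function.update_comm hdt, Function.update_idem, Function.update_of_ne hdt.symm,
        Function.update_self]

end PolyWord

namespace PolyFn

variable {F G N : List Bool → (Fin n → ℕ) → ℕ}

theorem const (c : ℕ) : PolyFn fun _ (_ : Fin n → ℕ) => c := by
  induction c with
  | zero => exact PolyWord.nil
  | succ c ih => exact (PolyWord.bit true).append ih

theorem length : PolyFn fun x (_ : Fin n → ℕ) => x.length := by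
  refine ⟨fun _ d t => copyLen 0 t d, 5 * Polynomial.X + 2, fun x ρ B hx _ => ?_⟩
  simp only [Polynomial.eval_add, Polynomial.eval_mul, Polynomial.eval_X, Polynomial.eval_ofNat,
    List.length_replicate]
  refine ⟨by omega, fun r d t s hs => ?_⟩
  have copied :=
    exec_copyLen hs.target_ne_zero.symm hs.free_pos.ne hs.target_lt.ne (hs.free d le_rfl)
  exact copied.congr (by rw [hs.input]; omega) (by rw [hs.input])

theorem proj (i : Fin n) : PolyFn fun _ ρ => ρ i := by
  refine ⟨fun r d t => copyLen (r i) t d, 5 * Polynomial.X + 2, fun x ρ B _ hρ => ?_⟩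
  have := hρ i
  simp only [Polynomial.eval_add, Polynomial.eval_mul, Polynomial.eval_X, Polynomial.eval_ofNat,
    List.length_replicate]
  refine ⟨by omega, fun r d t s hs => ?_⟩
  exact (exec_copyLen (hs.reg_ne i) (hs.reg_lt i).ne hs.target_lt.ne (hs.free d le_rfl)).congr
    (by rw [hs.reg, List.length_replicate]; omega) (by rw [hs.reg, List.length_replicate])

theorem reindex {F : List Bool → (Fin m → ℕ) → ℕ} (hF : PolyFn F) (f : Fin m → Fin n) :
    PolyFn fun x ρ => F x (ρ ∘ f) :=
  PolyWord.reindex hF f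

theorem weaken (hF : PolyFn F) : PolyFn fun x (ρ : Fin (n + 1) → ℕ) => F x (Fin.tail ρ) :=
  hF.reindex Fin.succ

theorem add (hF : PolyFn F) (hG : PolyFn G) : PolyFn fun x ρ => F x ρ + G x ρ :=
  (PolyWord.append hF hG).of_eq fun _ _ => List.replicate_append_replicate

theorem sum_range {G : List Bool → (Fin (n + 1) → ℕ) → ℕ} (hF : PolyFn F) (hG : PolyFn G) :
    PolyFn fun x ρ => ∑ i ∈ Finset.range (F x ρ), G x (Fin.cons i ρ) := by
  refine (PolyWord.flatMap_range hF hG).of_eq fun x ρ => ?_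
  beta_reduce
  induction F x ρ with
  | zero => rfl
  | succ N ih =>
    rw [List.range_succ, List.flatMap_append, ih, List.flatMap_singleton, Finset.sum_range_succ,
      List.replicate_append_replicate]

theorem mul (hF : PolyFn F) (hG : PolyFn G) : PolyFn fun x ρ => F x ρ * G x ρ :=
  (hF.sum_range hG.weaken).of_eq fun x ρ => by simp

theorem pred (hF : PolyFn F) : PolyFn fun x ρ => F x ρ - 1 := by
  obtain ⟨P, p, hP⟩ := hF
  refine ⟨fun r d t => seq (P r (d + 1) d) (seq (ifPop d fun _ => skip) (move d t)),
    p + (2 + (2 * p + 1)), fun x ρ B hx hρ => ?_⟩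
  obtain ⟨hp, execP⟩ := hP x ρ B hx hρ
  rw [List.length_replicate] at hp
  simp only [Polynomial.eval_add, Polynomial.eval_mul, Polynomial.eval_one, Polynomial.eval_ofNat,
    List.length_replicate]
  refine ⟨by omega, fun r d t s hs => ?_⟩
  have hdt := hs.target_lt.ne'
  have popped : Exec (ifPop d fun _ => skip) (update s d (num (F x ρ))) 2
      (update s d (num (F x ρ - 1))) :=
    .ifPop ((Exec.skip _).congr le_rfl (by simp))
  have moved := exec_move hdt (s := update s d (num (F x ρ - 1))) (Function.update_self ..)
  refine ((hs.exec_scratch execP).seq (popped.seq moved)).congr ?_ ?_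
  · rw [List.length_replicate]
    omega
  · rw [Function.update_idem, Function.update_of_ne hdt.symm, List.reverse_replicate,
      ← hs.free d le_rfl, Function.update_eq_self]

/-- The program that moves the top of stack `0` onto stack `a` as often as the number on stack `d`
says. -/
def skipInput (d a : ℕ) : StackProg :=
  loop d fun _ => ifPop 0 fun o => o.elim skip (push a)

/-- The program that pushes the top of stack `0`, as a number, onto stack `t`. -/
def readInput (t : ℕ) : StackProg :=
  ifPop 0 fun o => seq (if o.getD false then push t true else skip) (o.elim skip (push 0))

theorem exec_skipInput {d a i : ℕ} (hd : 0 < d) (ha : d < a) {s : ℕ → List Bool}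
    (hs : s d = num i) :
    Exec (skipInput d a) s (3 * i + 1)
      (update (update (update s d []) 0 ((s 0).drop i)) a (((s 0).take i).reverse ++ s a)) := by
  induction i generalizing s with
  | zero =>
    refine (Exec.loop_nil hs).congr le_rfl ?_
    funext j
    simp only [Function.update_apply]
    split_ifs <;> simp_all
  | succ i ih =>
    have h0a := (hd.trans ha).ne'
    set s₁ := update (update (update s d (num i)) 0 (s 0).tail) a ((s 0).head?.toList ++ s a)
      with hs₁
    have body : Exec (ifPop 0 fun o => o.elim skip (push a)) (update s d (num i)) 2 s₁ := by
      refine .ifPop ?_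
      rw [Function.update_of_ne hd.ne]
      cases h : s 0 with
      | nil => exact (Exec.skip _).congr le_rfl (by simp [hs₁, h, h0a, ha.ne'])
      | cons b l =>
        refine (Exec.push a b _).congr le_rfl ?_
        simp [hs₁, h, h0a, ha.ne']
    have rest := ih (s := s₁) (by simp [hs₁, hd.ne', ha.ne])
    refine (Exec.loop_cons (a := true) hs body rest).congr (by omega) ?_
    cases h : s 0
    all_goals
      funext j
      simp only [hs₁, h, Function.update_apply]
      split_ifs <;> simp_all

theorem exec_readInput {t : ℕ} (ht : t ≠ 0) (s : ℕ → List Bool) :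
    Exec (readInput t) s 3 (update s t (num ((s 0).getD 0 false).toNat ++ s t)) := by
  refine .ifPop (t := 1 + 1) ?_
  rcases h : s 0 with _ | ⟨_ | _, l⟩
  · refine ((Exec.skip _).seq (Exec.skip _)).congr le_rfl ?_
    funext j
    simp only [Function.update_apply]
    split_ifs <;> simp_all
  · refine ((Exec.skip _).seq (Exec.push 0 false _)).congr le_rfl ?_
    funext j
    simp only [Function.update_apply]
    split_ifs <;> simp_all
  · refine ((Exec.push t true _).seq (Exec.push 0 true _)).congr le_rfl ?_
    funext j
    simp only [Function.update_apply]
    split_ifs <;> simp_all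

theorem getD (hF : PolyFn F) : PolyFn fun x ρ => (x.getD (F x ρ) false).toNat := by
  obtain ⟨P, p, hP⟩ := hF
  refine ⟨fun r d t => seq (P r (d + 1) d) (seq (skipInput d (d + 1))
    (seq (readInput t) (move (d + 1) 0))),
    p + (3 * p + 1 + (3 + (2 * p + 1))), fun x ρ B hx hρ => ?_⟩
  obtain ⟨hp, execP⟩ := hP x ρ B hx hρ
  rw [List.length_replicate] at hp
  simp only [Polynomial.eval_add, Polynomial.eval_mul, Polynomial.eval_one, Polynomial.eval_ofNat,
    List.length_replicate]
  refine ⟨(Bool.toNat_le _).trans (by omega), fun r d t s hs => ?_⟩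
  have hdt := hs.target_lt
  have hd := hs.free_pos
  have skipped := exec_skipInput (s := update s d (num (F x ρ))) hd (Nat.lt_succ_self d)
    (Function.update_self ..)
  have moved := exec_move (Nat.succ_ne_zero d) (l := (x.take (F x ρ)).reverse) (s := update (update
    (update s 0 (x.drop (F x ρ))) (d + 1) (x.take (F x ρ)).reverse) t
    (num (x.getD (F x ρ) false).toNat ++ s t)) (by simp [(hdt.trans d.lt_succ_self).ne'])
  have hd₀ := hs.free d le_rfl
  have hd₁ := hs.free (d + 1) (Nat.le_succ d)
  have ht := hs.target_ne_zero
  have hx := hs.input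
  refine ((hs.exec_scratch execP).seq (skipped.seq
    (((exec_readInput ht _).congr le_rfl ?_).seq moved))).congr ?_ ?_
  · funext j
    simp only [Function.update_apply]
    split_ifs <;> simp_all
  · simp only [List.length_reverse, List.length_take]
    omega
  · funext j
    simp only [Function.update_apply]
    split_ifs <;> simp_all

theorem exec_loop_iterate {f : ℕ → ℕ} {Q : StackProg} {d N C T a : ℕ} {s : ℕ → List Bool}
    (hs : ∀ j, d ≤ j → s j = []) (hC : ∀ i ≤ N, f^[i] a ≤ C)
    (hQ : ∀ m, ∀ b ≤ C, Exec Q (update (update s d (num m)) (d + 1) (num b)) T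
      (update (update (update s d (num m)) (d + 1) (num b)) (d + 2) (num (f b)))) :
    Exec (loop d fun _ => seq Q (seq (clear (d + 1)) (move (d + 2) (d + 1))))
      (update (update s d (num N)) (d + 1) (num a)) (N * (T + 4 * C + 3) + 1)
      (update s (d + 1) (num (f^[N] a))) := by
  induction N generalizing a with
  | zero =>
    refine (Exec.loop_nil (by simp)).congr (by omega) ?_
    rw [show num 0 = s d from (hs d le_rfl).symm, Function.update_eq_self]
    rfl
  | succ N ih =>
    have ha : a ≤ C := hC 0 (Nat.zero_le _)
    have hfa : f a ≤ C := hC 1 (by omega)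
    set s' := update (update s d (num N)) (d + 1) (num a) with hs'
    have popped : update (update (update s d (num (N + 1))) (d + 1) (num a)) d (num N) = s' := by
      rw [Function.update_comm (Nat.succ_ne_self d), Function.update_idem]
    have cleared := exec_clear (a := d + 1) (l := num a) (s := update s' (d + 2) (num (f a)))
      (by simp [hs'])
    have moved := exec_move (a := d + 2) (b := d + 1) (by omega) (l := num (f a))
      (s := update (update s' (d + 2) (num (f a))) (d + 1) []) (by simp)
    rw [List.length_replicate] at cleared moved
    have body : Exec (seq Q (seq (clear (d + 1)) (move (d + 2) (d + 1)))) s' (T + 4 * C + 2)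
        (update (update s d (num N)) (d + 1) (num (f a))) := by
      refine ((hQ N a ha).seq (cleared.seq moved)).congr (by omega) ?_
      have := hs (d + 2) (by omega)
      funext j
      simp only [hs', Function.update_apply]
      split_ifs <;> simp_all
    have rest := ih (a := f a) fun i hi => hC (i + 1) (by omega)
    rw [Nat.succ_mul, Function.iterate_succ_apply]
    exact (Exec.loop_cons (a := true) (l := num N) (by simp [List.replicate_succ])
      (by rwa [popped]) rest).congr (by omega) rfl

/-- The bound has to hold for all the intermediate results, since the step function may be applied
to each of them. -/
theorem iterate {f : List Bool → (Fin (n + 1) → ℕ) → ℕ} (hF : PolyFn F) (hf : PolyFn f)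
    (hN : PolyFn N) (c : Polynomial ℕ)
    (hc : ∀ x ρ B, x.length ≤ B → (∀ i, ρ i ≤ B) → ∀ i ≤ N x ρ,
      (fun a => f x (Fin.cons a ρ))^[i] (F x ρ) ≤ c.eval B) :
    PolyFn fun x ρ => (fun a => f x (Fin.cons a ρ))^[N x ρ] (F x ρ) := by
  obtain ⟨P, p, hP⟩ := hF
  obtain ⟨Q, q, hQ⟩ := hf
  obtain ⟨R, k, hR⟩ := hN
  refine ⟨fun r d t => seq (R r (d + 1) d) (seq (P r (d + 2) (d + 1))
    (seq (loop d fun _ => seq (Q (Fin.cons (d + 1) r) (d + 3) (d + 2))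
      (seq (clear (d + 1)) (move (d + 2) (d + 1)))) (move (d + 1) t))),
    k + (p + (k * (q.comp (Polynomial.X + c) + 4 * c + 3) + 1 + (2 * c + 1))),
    fun x ρ B hx hρ => ?_⟩
  obtain ⟨-, execP⟩ := hP x ρ B hx hρ
  obtain ⟨hk, execR⟩ := hR x ρ B hx hρ
  have hc := hc x ρ B hx hρ
  rw [List.length_replicate] at hk
  simp only [Polynomial.eval_add, Polynomial.eval_mul, Polynomial.eval_one, Polynomial.eval_ofNat,
    Polynomial.eval_comp, Polynomial.eval_X, List.length_replicate]
  refine ⟨(hc _ le_rfl).trans (by omega), fun r d t s hs => ?_⟩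
  have base := (hs.update_scratch (num (N x ρ))).exec_scratch execP
  have body : ∀ m, ∀ b ≤ c.eval B, _ := fun m b hb =>
    ((hs.update_scratch (num m)).bind b).exec_scratch
      (hQ x (Fin.cons b ρ) (B + c.eval B) (by omega)
        (PolyWord.cons_le (by omega) fun i => (hρ i).trans (by omega))).2
  have looped := exec_loop_iterate hs.free hc body
  have hdt : d + 1 ≠ t := (Nat.lt_succ_of_lt hs.target_lt).ne'
  have moved := exec_move hdt
    (s := update s (d + 1) (num ((fun a => f x (Fin.cons a ρ))^[N x ρ] (F x ρ))))
    (Function.update_self ..)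
  refine ((hs.exec_scratch execR).seq (base.seq (looped.seq moved))).congr ?_ ?_
  · rw [List.length_replicate]
    gcongr
    exact hc _ le_rfl
  · have hd₁ := hs.free (d + 1) (Nat.le_succ d)
    funext j
    simp only [Function.update_apply]
    split_ifs <;> simp_all

end PolyFn

open PolyFn (const proj)

theorem PolyFn.sub {F G : List Bool → (Fin n → ℕ) → ℕ} (hF : PolyFn F) (hG : PolyFn G) :
    PolyFn fun x ρ => F x ρ - G x ρ := by
  obtain ⟨c, hc⟩ := hF.exists_bound
  refine (hF.iterate (proj 0).pred hG c fun x ρ B hx hρ i _ => ?_).of_eq fun x ρ =>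
    Nat.pred_iterate _ _
  exact (Nat.pred_iterate _ _).trans_le ((Nat.sub_le _ _).trans (hc x ρ B hx hρ))

namespace PolyPred

variable {p q : List Bool → (Fin n → ℕ) → Prop}

theorem not (hp : PolyPred p) : PolyPred fun x ρ => ¬ p x ρ :=
  PolyFn.of_eq ((const 1).sub hp) fun x ρ => by by_cases h : p x ρ <;> simp [h]

theorem and (hp : PolyPred p) (hq : PolyPred q) : PolyPred fun x ρ => p x ρ ∧ q x ρ :=
  PolyFn.of_eq (PolyFn.mul hp hq) fun x ρ => by
    by_cases h : p x ρ <;> by_cases h' : q x ρ <;> simp [h, h']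

theorem or (hp : PolyPred p) (hq : PolyPred q) : PolyPred fun x ρ => p x ρ ∨ q x ρ :=
  (hp.not.and hq.not).not.of_iff fun _ _ => or_iff_not_and_not.symm

open Classical in
theorem decide (hp : PolyPred p) : PolyWord fun x ρ => [decide (p x ρ)] :=
  ((PolyWord.flatMap_range hp (PolyWord.bit true)).append
    (PolyWord.flatMap_range hp.not (PolyWord.bit false))).of_eq fun x ρ => by
      by_cases h : p x ρ <;> simp [h]

end PolyPred

namespace PolyFn

variable {F G H : List Bool → (Fin n → ℕ) → ℕ}

theorem le (hF : PolyFn F) (hG : PolyFn G) : PolyPred fun x ρ => F x ρ ≤ G x ρ :=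
  of_eq ((const 1).sub (hF.sub hG)) fun x ρ => by split_ifs <;> omega

theorem lt (hF : PolyFn F) (hG : PolyFn G) : PolyPred fun x ρ => F x ρ < G x ρ :=
  (hG.le hF).not.of_iff fun _ _ => not_le

theorem eq (hF : PolyFn F) (hG : PolyFn G) : PolyPred fun x ρ => F x ρ = G x ρ :=
  ((hF.le hG).and (hG.le hF)).of_iff fun _ _ => le_antisymm_iff.symm

open Classical in
theorem card_filter_range {P : List Bool → (Fin (n + 1) → ℕ) → Prop} (hF : PolyFn F)
    (hP : PolyPred P) :
    PolyFn fun x ρ => ((Finset.range (F x ρ)).filter fun i => P x (Fin.cons i ρ)).card :=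
  (hF.sum_range hP).of_eq fun x ρ => by rw [Finset.card_filter]

theorem of_lt_iff {P : List Bool → (Fin (n + 1) → ℕ) → Prop} (hF : PolyFn F) (hP : PolyPred P)
    (hle : ∀ x ρ, H x ρ ≤ F x ρ) (hlt : ∀ x ρ i, i < H x ρ ↔ P x (Fin.cons i ρ)) : PolyFn H := by
  classical
  refine (hF.card_filter_range hP).of_eq fun x ρ => ?_
  have : ((Finset.range (F x ρ)).filter fun i => P x (Fin.cons i ρ)) = Finset.range (H x ρ) := by
    ext i
    rw [Finset.mem_filter, Finset.mem_range, Finset.mem_range, ← hlt, and_iff_right_iff_imp]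
    exact fun hi => hi.trans_le (hle x ρ)
  rw [this, Finset.card_range]

theorem div (hF : PolyFn F) (hG : PolyFn G) : PolyFn fun x ρ => F x ρ / G x ρ := by
  refine of_lt_iff (P := fun x ρ => 0 < G x (Fin.tail ρ) ∧
      (ρ 0 + 1) * G x (Fin.tail ρ) ≤ F x (Fin.tail ρ)) hF
    (((const 0).lt hG.weaken).and ((((proj 0).add (const 1)).mul hG.weaken).le hF.weaken))
    (fun x ρ => Nat.div_le_self _ _) fun x ρ i => ?_
  rw [Fin.tail_cons, Fin.cons_zero]
  rcases Nat.eq_zero_or_pos (G x ρ) with h | h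
  · simp [h]
  · rw [and_iff_right h, ← Nat.le_div_iff_mul_le h, Nat.succ_le_iff]

theorem mod (hF : PolyFn F) (hG : PolyFn G) : PolyFn fun x ρ => F x ρ % G x ρ :=
  (hF.sub (hG.mul (hF.div hG))).of_eq fun _ _ => (Nat.mod_eq_sub _ _).symm

theorem div_pow (b : ℕ) (hF : PolyFn F) (hG : PolyFn G) : PolyFn fun x ρ => F x ρ / b ^ G x ρ := by
  have iterate_div : ∀ a i, (fun a => a / b)^[i] a = a / b ^ i := fun a i => by
    induction i with
    | zero => simp
    | succ i ih => rw [Function.iterate_succ_apply', ih, Nat.div_div_eq_div_mul, ← pow_succ]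
  obtain ⟨c, hc⟩ := hF.exists_bound
  refine (hF.iterate ((proj 0).div (const b)) hG c fun x ρ B hx hρ i _ => ?_).of_eq fun x ρ =>
    iterate_div _ _
  exact (iterate_div _ _).trans_le ((Nat.div_le_self _ _).trans (hc x ρ B hx hρ))

theorem toNat_testBit (hF : PolyFn F) (hG : PolyFn G) :
    PolyFn fun x ρ => ((F x ρ).testBit (G x ρ)).toNat :=
  ((hF.div_pow 2 hG).mod (const 2)).of_eq fun _ _ => (Nat.toNat_testBit _ _).symm

theorem log {b : ℕ} (hb : 1 < b) (hF : PolyFn F) : PolyFn fun x ρ => Nat.log b (F x ρ) := by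
  refine of_lt_iff (P := fun x ρ => 1 ≤ F x (Fin.tail ρ) / b ^ (ρ 0 + 1)) hF
    ((const 1).le (hF.weaken.div_pow b ((proj 0).add (const 1))))
    (fun x ρ => Nat.log_le_self _ _) fun x ρ i => ?_
  rw [Fin.tail_cons, Fin.cons_zero, Nat.one_le_div_iff (Nat.pow_pos (by omega)),
    ← Nat.succ_le_iff]
  rcases eq_or_ne (F x ρ) 0 with h | h
  · simp [h, (zero_lt_one.trans hb).ne']
  · exact Nat.le_log_iff_pow_le hb h

theorem two_pow (hF : PolyFn F) (hG : PolyFn G) (hle : ∀ x ρ, 2 ^ F x ρ ≤ G x ρ) :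
    PolyFn fun x ρ => 2 ^ F x ρ := by
  obtain ⟨c, hc⟩ := hG.exists_bound
  refine ((const 1).iterate ((const 2).mul (proj 0)) hF c fun x ρ B hx hρ i hi => ?_).of_eq
    fun x ρ => mul_left_iterate_apply_one _
  exact (mul_left_iterate_apply_one _).trans_le
    ((Nat.pow_le_pow_right two_pos hi).trans ((hle x ρ).trans (hc x ρ B hx hρ)))

end PolyFn

end StackProg

open StackProg

theorem StackProg.PolyWord.exists_exec {F : List Bool → (Fin 0 → ℕ) → List Bool}
    (hF : PolyWord F) : ∃ (R : StackProg) (q : Polynomial ℕ), ∀ x,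
      (F x Fin.elim0).length ≤ q.eval x.length ∧
      Exec R (update (fun _ => []) 0 x) (q.eval x.length)
        (update (fun _ => []) 1 (F x Fin.elim0).reverse) := by
  obtain ⟨P, q, hP⟩ := hF
  refine ⟨seq (P Fin.elim0 3 2) (seq (move 2 1) (clear 0)),
    q + ((2 * q + 1) + (2 * Polynomial.X + 1)), fun x => ?_⟩
  obtain ⟨hq, exec⟩ := hP x Fin.elim0 x.length le_rfl (fun i => i.elim0)
  simp only [Polynomial.eval_add, Polynomial.eval_mul, Polynomial.eval_X, Polynomial.eval_one,
    Polynomial.eval_ofNat]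
  refine ⟨by omega, ?_⟩
  have ready : Ready x Fin.elim0 Fin.elim0 3 2 (update (fun _ => []) 0 x) :=
    ⟨by omega, by omega, fun i => i.elim0, fun i => i.elim0, by simp, fun i => i.elim0,
      fun j hj => Function.update_of_ne (by omega) ..⟩
  have moved := exec_move (a := 2) (b := 1) (by omega) (l := F x Fin.elim0)
    (s := update (update (fun _ => []) 0 x) 2 (F x Fin.elim0)) (by simp)
  have cleared := exec_clear (a := 0) (l := x)
    (s := update (update (fun _ => []) 0 x) 1 (F x Fin.elim0).reverse) (by simp)
  refine ((exec _ 3 2 _ ready).congr le_rfl (by simp)).seq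
    (((moved.congr (by omega) ?_).seq cleared).congr le_rfl ?_)
  all_goals
    funext j
    simp only [Function.update_apply]
    split_ifs <;> simp_all

theorem SolvableInOStar.of_reduction {α β : Type} {enc : α → List Bool} {enc' : β → List Bool}
    {P : α → Prop} {P' : β → Prop} {T : α → ℝ} {T' : β → ℝ}
    {F : List Bool → (Fin 0 → ℕ) → List Bool} (h : SolvableInOStar enc' P' T') (hF : PolyWord F)
    (g : α → β) (hg : ∀ a ρ, F (enc a) ρ = enc' (g a)) (hP : ∀ a, P' (g a) ↔ P a)
    (hT : ∀ a, 1 ≤ T a) {C : ℕ} (hT' : ∀ a, T' (g a) ≤ C * T a) : SolvableInOStar enc P T := by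
  obtain ⟨M, p, hM⟩ := h
  obtain ⟨R, q, hR⟩ := hF.exists_exec
  refine ⟨prepend R.maxStack M R, q + (q + 1) + (C : Polynomial ℕ) * p.comp q, fun a => ?_⟩
  obtain ⟨hq, exec⟩ := hR (enc a)
  obtain ⟨b, t, hb, ht, outputs⟩ := hM (g a)
  rw [hg] at hq exec
  set Q := q.eval (enc a).length
  have ht' : (t : ℝ) ≤ T a * (C * p.eval Q : ℕ) := calc
    (t : ℝ) ≤ T' (g a) * (p.eval (enc' (g a)).length : ℕ) := ht
    _ ≤ C * T a * (p.eval Q : ℕ) :=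
      mul_le_mul (hT' a) (Nat.cast_le.2 (eval_monotone p hq)) (Nat.cast_nonneg _)
        (mul_nonneg (Nat.cast_nonneg _) (zero_le_one.trans (hT a)))
    _ = T a * (C * p.eval Q : ℕ) := by push_cast; ring
  have hprog : ((Q + ((enc' (g a)).length + 1) : ℕ) : ℝ) ≤ T a * (Q + (Q + 1) : ℕ) :=
    (Nat.cast_le.2 (by omega)).trans (le_mul_of_one_le_left (Nat.cast_nonneg _) (hT a))
  refine ⟨b, Q + ((enc' (g a)).length + 1) + t, hb.trans (hP a), ?_, ?_⟩
  · simp only [Polynomial.eval_add, Polynomial.eval_one, Polynomial.eval_mul,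
      Polynomial.eval_comp, Polynomial.eval_natCast, Nat.cast_id]
    rw [Nat.cast_add, Nat.cast_add _ (C * _), mul_add]
    exact add_le_add hprog ht'
  · have input : (enc a).map (prepend R.maxStack M R).inputAlphabet.symm = enc a := List.map_id _
    exact input.symm ▸ prepend_outputs (Nat.le_succ _) exec outputs

/-! ### Majorities and incidence graphs -/

/-- `S` contains more than half of the elements of `T`, or none of them. -/
def Dominates {α : Type*} [DecidableEq α] (S T : Finset α) : Prop :=
  (S ∩ T).Nonempty → T.card < 2 * (S ∩ T).card

section Graph

variable {V : Type*} [Fintype V] [DecidableEq V] {G : SimpleGraph V} {S : Finset V}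

theorem degreeIn_add_degreeIn_compl (G : SimpleGraph V) (S : Finset V) (v : V) :
    G.degreeIn S v + G.degreeIn Sᶜ v = G.degreeIn Finset.univ v := by
  classical
  unfold SimpleGraph.degreeIn
  rw [← Finset.card_union_of_disjoint (Finset.disjoint_filter_filter disjoint_compl_right),
    ← Finset.filter_union, Finset.union_compl]

theorem mem_of_adj_of_two_mul_card_le_degreeIn_univ (hS : G.IsOffensiveAlliance S) {u v : V}
    (hu : u ∈ S) (huv : G.Adj u v) (hv : 2 * S.card ≤ G.degreeIn Finset.univ v) : v ∈ S := by
  classical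
  by_contra hvS
  have alliance := hS.2 v ⟨hvS, u, hu, huv⟩
  have total := degreeIn_add_degreeIn_compl G S v
  have degree_le : G.degreeIn S v ≤ S.card := Finset.card_filter_le _ _
  omega

end Graph

/-- The bipartite graph between the elements `0, …, E - 1` and `t` copies of each of the sets
`W 0, …, W (C - 1)`, in which an element is adjacent to the sets it belongs to; the copies of `W c`
are the vertices from `E + t * c` on. -/
def incidenceGraph (E C t : ℕ) (W : ℕ → Finset ℕ) : SimpleGraph (Fin (E + C * t)) where
  Adj u v := ((u : ℕ) < E ∧ E ≤ v ∧ (u : ℕ) ∈ W ((v - E) / t)) ∨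
    ((v : ℕ) < E ∧ E ≤ u ∧ (v : ℕ) ∈ W ((u - E) / t))
  symm := ⟨fun _ _ h => h.symm⟩
  loopless := ⟨fun u h => by omega⟩

namespace incidenceGraph

variable {E C t : ℕ} {W : ℕ → Finset ℕ}

/-- The vertex of the `i`-th copy of the set `W c`. -/
def copy (E : ℕ) (c : Fin C) (i : Fin t) : Fin (E + C * t) :=
  Fin.natAdd E (finProdFinEquiv (c, i))

theorem lt_or_exists_eq_copy (v : Fin (E + C * t)) :
    (v : ℕ) < E ∨ ∃ (c : Fin C) (i : Fin t), v = copy E c i := by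
  induction v using Fin.addCases with
  | left e => exact Or.inl e.2
  | right j =>
    exact Or.inr ⟨_, _, congrArg (Fin.natAdd E) (finProdFinEquiv.apply_symm_apply j).symm⟩

theorem not_adj_of_lt {u v : Fin (E + C * t)} (hu : (u : ℕ) < E) (hv : (v : ℕ) < E) :
    ¬ (incidenceGraph E C t W).Adj u v := by
  rintro (⟨-, h, -⟩ | ⟨-, h, -⟩)
  · exact h.not_gt hv
  · exact h.not_gt hu

theorem adj_copy_iff {c : Fin C} (hW : W c ⊆ Finset.range E) (i : Fin t) (v : Fin (E + C * t)) :
    (incidenceGraph E C t W).Adj (copy E c i) v ↔ (v : ℕ) ∈ W c := by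
  have index : ((copy E c i : ℕ) - E) / t = c := by
    rw [copy, Fin.val_natAdd, Nat.add_sub_cancel_left, finProdFinEquiv_apply_val,
      Nat.add_mul_div_left _ _ i.pos, Nat.div_eq_of_lt i.2, Nat.zero_add]
  have hle : E ≤ copy E c i := Nat.le_add_right _ _
  constructor
  · rintro (⟨h, -⟩ | ⟨-, -, h⟩)
    · exact absurd h hle.not_gt
    · rwa [index] at h
  · exact fun h => Or.inr ⟨Finset.mem_range.1 (hW h), hle, by rwa [index]⟩

/-- The vertices that are elements of `S`. -/
def vertexSet (S : Finset ℕ) : Finset (Fin (E + C * t)) :=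
  Finset.univ.filter fun v => (v : ℕ) ∈ S

theorem mem_vertexSet {S : Finset ℕ} {v : Fin (E + C * t)} : v ∈ vertexSet S ↔ (v : ℕ) ∈ S := by
  rw [vertexSet, Finset.mem_filter, and_iff_right (Finset.mem_univ v)]

theorem map_vertexSet {S : Finset ℕ} (hS : S ⊆ Finset.range (E + C * t)) :
    (vertexSet S : Finset (Fin (E + C * t))).map Fin.valEmbedding = S := by
  ext e
  simp only [Finset.mem_map, mem_vertexSet, Fin.valEmbedding_apply]
  exact ⟨fun ⟨_, hv, hve⟩ => hve ▸ hv, fun he => ⟨⟨e, Finset.mem_range.1 (hS he)⟩, he, rfl⟩⟩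

theorem degreeIn_vertexSet_copy {c : Fin C} (hW : W c ⊆ Finset.range E) (S : Finset ℕ)
    (i : Fin t) :
    (incidenceGraph E C t W).degreeIn (vertexSet S) (copy E c i) = (S ∩ W c).card := by
  classical
  have neighbours : (vertexSet S).filter ((incidenceGraph E C t W).Adj (copy E c i)) =
      vertexSet (S ∩ W c) := by
    ext v
    rw [Finset.mem_filter, adj_copy_iff hW, mem_vertexSet, mem_vertexSet, Finset.mem_inter]
  have subset : S ∩ W c ⊆ Finset.range (E + C * t) :=
    (Finset.inter_subset_right.trans hW).trans (Finset.range_mono (Nat.le_add_right _ _))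
  rw [← map_vertexSet subset, Finset.card_map, ← neighbours, SimpleGraph.degreeIn]

theorem degreeIn_univ_copy {c : Fin C} (hW : W c ⊆ Finset.range E) (i : Fin t) :
    (incidenceGraph E C t W).degreeIn Finset.univ (copy E c i) = (W c).card := by
  have univ_eq : (Finset.univ : Finset (Fin (E + C * t))) =
      vertexSet (Finset.range (E + C * t)) := by
    ext v
    simp only [Finset.mem_univ, mem_vertexSet, Finset.mem_range, v.2]
  rw [univ_eq, degreeIn_vertexSet_copy hW, Finset.inter_eq_right.2
    (hW.trans (Finset.range_mono (Nat.le_add_right _ _)))]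

theorem degreeIn_compl_add_one_le_iff {c : Fin C} (hW : W c ⊆ Finset.range E) (S : Finset ℕ)
    (i : Fin t) :
    (incidenceGraph E C t W).degreeIn (vertexSet S)ᶜ (copy E c i) + 1 ≤
        (incidenceGraph E C t W).degreeIn (vertexSet S) (copy E c i) ↔
      (W c).card < 2 * (S ∩ W c).card := by
  have total := degreeIn_add_degreeIn_compl (incidenceGraph E C t W) (vertexSet S) (copy E c i)
  rw [degreeIn_vertexSet_copy hW, degreeIn_univ_copy hW] at total
  rw [degreeIn_vertexSet_copy hW]
  omega

theorem le_degreeIn_univ {c : Fin C} (hW : W c ⊆ Finset.range E) {v : Fin (E + C * t)}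
    (hv : (v : ℕ) ∈ W c) : t ≤ (incidenceGraph E C t W).degreeIn Finset.univ v := by
  classical
  have card_le : (Finset.univ : Finset (Fin t)).card ≤
      (incidenceGraph E C t W).degreeIn Finset.univ v := by
    refine Finset.card_le_card_of_injOn (copy E c) (fun i _ => ?_) fun i _ j _ hij => ?_
    · exact Finset.mem_coe.2
        (Finset.mem_filter.2 ⟨Finset.mem_univ _, ((adj_copy_iff hW i v).2 hv).symm⟩)
    · exact (Prod.mk.inj (finProdFinEquiv.injective (Fin.natAdd_injective _ _ hij))).2
  rwa [Finset.card_univ, Fintype.card_fin] at card_le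

theorem isOffensiveAlliance_vertexSet_iff (hW : ∀ c, W c ⊆ Finset.range E) (ht : 0 < t)
    {S : Finset ℕ} (hS : S ⊆ Finset.range E) :
    (incidenceGraph E C t W).IsOffensiveAlliance (vertexSet S) ↔
      S.Nonempty ∧ ∀ c < C, Dominates S (W c) := by
  have vertex : ∀ e ∈ S, ∃ v : Fin (E + C * t), (v : ℕ) = e := fun e he =>
    ⟨⟨e, (Finset.mem_range.1 (hS he)).trans_le (Nat.le_add_right _ _)⟩, rfl⟩
  constructor
  · rintro ⟨⟨v, hv⟩, majority⟩
    refine ⟨⟨v, mem_vertexSet.1 hv⟩, fun c hc ⟨e, he⟩ => ?_⟩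
    obtain ⟨heS, heW⟩ := Finset.mem_inter.1 he
    obtain ⟨u, rfl⟩ := vertex e heS
    refine (degreeIn_compl_add_one_le_iff (hW _) S ⟨0, ht⟩).1 (majority (copy E ⟨c, hc⟩ ⟨0, ht⟩)
      ⟨fun h => ?_, u, mem_vertexSet.2 heS, ((adj_copy_iff (hW _) _ u).2 heW).symm⟩)
    exact (Finset.mem_range.1 (hS (mem_vertexSet.1 h))).not_ge (Nat.le_add_right _ _)
  · rintro ⟨⟨e, he⟩, dominates⟩
    obtain ⟨u, rfl⟩ := vertex e he
    refine ⟨⟨u, mem_vertexSet.2 he⟩, ?_⟩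
    rintro v ⟨-, u, hu, huv⟩
    rw [mem_vertexSet] at hu
    rcases lt_or_exists_eq_copy v with hv | ⟨c, i, rfl⟩
    · exact absurd huv (not_adj_of_lt (Finset.mem_range.1 (hS hu)) hv)
    · exact (degreeIn_compl_add_one_le_iff (hW _) S i).2 (dominates c c.2
        ⟨u, Finset.mem_inter.2 ⟨hu, (adj_copy_iff (hW _) i u).1 huv.symm⟩⟩)

theorem copy_notMem (hW : ∀ c, W c ⊆ Finset.range E) {S : Finset (Fin (E + C * t))}
    (hS : (incidenceGraph E C t W).IsOffensiveAlliance S) (ht : 2 * S.card ≤ t) {c : Fin C}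
    (hc : S.card < (W c).card) (i : Fin t) : copy E c i ∉ S := by
  intro hmem
  have subset : W c ⊆ S.map Fin.valEmbedding := fun e he => by
    refine Finset.mem_map.2 ⟨⟨e, (Finset.mem_range.1 (hW c he)).trans_le (Nat.le_add_right _ _)⟩,
      ?_, rfl⟩
    exact mem_of_adj_of_two_mul_card_le_degreeIn_univ hS hmem ((adj_copy_iff (hW c) i _).2 he)
      (ht.trans (le_degreeIn_univ (hW c) he))
  exact hc.not_ge ((Finset.card_le_card subset).trans_eq (Finset.card_map _))

/-- Enough copies exclude the sets from a small alliance, as their elements would have to be in it;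
an alliance that consists of elements outvotes every copy of a set that it meets. -/
theorem exists_isOffensiveAlliance_iff {k : ℕ} (hW : ∀ c, W c ⊆ Finset.range E) (hk : 0 < k)
    (ht : 2 * k ≤ t) (hcard : ∀ c < C, k < (W c).card) :
    (∃ S, (incidenceGraph E C t W).IsOffensiveAlliance S ∧ S.card ≤ k) ↔
      ∃ S ⊆ Finset.range E, S.Nonempty ∧ S.card ≤ k ∧ ∀ c < C, Dominates S (W c) := by
  have ht0 : 0 < t := by omega
  constructor
  · rintro ⟨S, alliance, hSk⟩
    have subset : S.map Fin.valEmbedding ⊆ Finset.range E := by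
      intro e he
      obtain ⟨v, hv, rfl⟩ := Finset.mem_map.1 he
      rcases lt_or_exists_eq_copy v with hlt | ⟨c, i, rfl⟩
      · exact Finset.mem_range.2 hlt
      · exact absurd hv (copy_notMem hW alliance (by omega) (hSk.trans_lt (hcard c c.2)) i)
    have eq_vertexSet : S = vertexSet (S.map Fin.valEmbedding) := by
      ext v
      rw [mem_vertexSet]
      exact (Finset.mem_map' Fin.valEmbedding).symm
    rw [eq_vertexSet, isOffensiveAlliance_vertexSet_iff hW ht0 subset] at alliance
    exact ⟨_, subset, alliance.1, (Finset.card_map _).trans_le hSk, alliance.2⟩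
  · rintro ⟨S, subset, nonempty, hSk, dominates⟩
    refine ⟨vertexSet S,
      (isOffensiveAlliance_vertexSet_iff hW ht0 subset).2 ⟨nonempty, dominates⟩, ?_⟩
    rwa [← Finset.card_map Fin.valEmbedding,
      map_vertexSet (subset.trans (Finset.range_mono (Nat.le_add_right _ _)))]

end incidenceGraph

/-! ### Selecting one element from each group -/

section Dominates

variable {α : Type*} [DecidableEq α] {S A P : Finset α}

theorem card_inter_union_of_disjoint (S : Finset α) (hAP : Disjoint A P) :
    (S ∩ (A ∪ P)).card = (S ∩ A).card + (S ∩ P).card := by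
  rw [Finset.inter_union_distrib_left, Finset.card_union_of_disjoint
    (hAP.mono Finset.inter_subset_right Finset.inter_subset_right)]

theorem Dominates.card_add_card_lt (h : Dominates S (A ∪ P)) (hAP : Disjoint A P)
    (hS : (S ∩ (A ∪ P)).Nonempty) :
    A.card + P.card < 2 * ((S ∩ A).card + (S ∩ P).card) := by
  rw [← card_inter_union_of_disjoint S hAP, ← Finset.card_union_of_disjoint hAP]
  exact h hS

theorem Dominates.inter_left_nonempty (h : Dominates S (A ∪ P)) (hAP : Disjoint A P)
    (hle : P.card ≤ A.card) (hS : (S ∩ (A ∪ P)).Nonempty) : (S ∩ A).Nonempty := by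
  rw [← Finset.card_pos]
  have majority := h.card_add_card_lt hAP hS
  have inter_le : (S ∩ P).card ≤ P.card := Finset.card_le_card Finset.inter_subset_right
  omega

theorem dominates_union_of_subset (hAP : Disjoint A P) (hAS : A ⊆ S)
    (h : P.card < A.card + 2 * (S ∩ P).card) : Dominates S (A ∪ P) := by
  intro _
  rw [card_inter_union_of_disjoint S hAP, Finset.card_union_of_disjoint hAP,
    Finset.inter_eq_right.2 hAS]
  omega

/-- Every element of `A` missing from `S` has to be made up for in each of the at least two sets
`B i`, which costs more than it saves. -/
theorem subset_and_card_inter_eq_one {ι : Type*} {I : Finset ι} {B : ι → Finset α}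
    (hI : 2 ≤ I.card) (hAB : ∀ i ∈ I, Disjoint A (B i)) (hB : (I : Set ι).PairwiseDisjoint B)
    (hcard : S.card ≤ A.card + I.card)
    (hlt : ∀ i ∈ I, A.card < (S ∩ A).card + (S ∩ B i).card) :
    S ⊆ A ∪ I.biUnion B ∧ ∀ i ∈ I, (S ∩ B i).card = 1 := by
  have split : (S ∩ (A ∪ I.biUnion B)).card = (S ∩ A).card + ∑ i ∈ I, (S ∩ B i).card := by
    rw [card_inter_union_of_disjoint S ((Finset.disjoint_biUnion_right A I B).2 hAB),
      Finset.inter_biUnion, Finset.card_biUnion]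
    exact fun i hi j hj hij =>
      (hB hi hj hij).mono Finset.inter_subset_right Finset.inter_subset_right
  have split_le : (S ∩ (A ∪ I.biUnion B)).card ≤ S.card :=
    Finset.card_le_card Finset.inter_subset_left
  obtain ⟨missing, hmissing⟩ : ∃ m, A.card = (S ∩ A).card + m :=
    Nat.exists_eq_add_of_le (Finset.card_le_card Finset.inter_subset_right)
  have le_sum : I.card * (missing + 1) ≤ ∑ i ∈ I, (S ∩ B i).card :=
    Finset.card_nsmul_le_sum I (fun i => (S ∩ B i).card) _ fun i hi => by
      have lt := hlt i hi
      omega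
  have two_mul_le : 2 * missing ≤ I.card * missing := Nat.mul_le_mul_right _ hI
  rw [Nat.mul_succ] at le_sum
  have missing_eq : missing = 0 := by omega
  refine ⟨?_, fun i hi => ?_⟩
  · rw [← Finset.inter_eq_left]
    exact Finset.eq_of_subset_of_card_le Finset.inter_subset_left (by omega)
  · have one_le : ∀ i ∈ I, 1 ≤ (S ∩ B i).card := fun i hi => by
      have lt := hlt i hi
      omega
    have sum_eq : ∑ _ ∈ I, 1 = ∑ i ∈ I, (S ∩ B i).card := by
      rw [← Finset.card_eq_sum_ones]
      omega
    exact ((Finset.sum_eq_sum_iff_of_le one_le).1 sum_eq i hi).symm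

end Dominates

/-- The `i`-th block of `h` consecutive natural numbers. -/
def block (h i : ℕ) : Finset ℕ := Finset.Ico (i * h) ((i + 1) * h)

section Block

variable {h i j a : ℕ}

theorem mem_block_iff {e : ℕ} (hh : 0 < h) : e ∈ block h i ↔ e / h = i := by
  rw [block, Finset.mem_Ico, Nat.div_eq_iff hh, Nat.succ_mul]
  omega

theorem mul_add_mem_block (ha : a < h) : i * h + a ∈ block h i :=
  Finset.mem_Ico.2 ⟨Nat.le_add_right _ _, by rw [Nat.succ_mul]; omega⟩

theorem card_block (h i : ℕ) : (block h i).card = h := by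
  rw [block, Nat.card_Ico, Nat.succ_mul, Nat.add_sub_cancel_left]

theorem disjoint_block (hij : i ≠ j) : Disjoint (block h i) (block h j) := by
  rcases h.eq_zero_or_pos with rfl | hh
  · exact Finset.disjoint_left.2 fun e he => by simp [block] at he
  · rw [Finset.disjoint_left]
    intro e hi hj
    exact hij (((mem_block_iff hh).1 hi).symm.trans ((mem_block_iff hh).1 hj))

end Block

namespace Selection

section Definitions

variable (g h : ℕ) (valid : ℕ → Prop) (sat : ℕ → ℕ → ℕ → Prop)

open Classical in
/-- The candidates that meet the constraint `j`. The block `i < g` holds the candidates of the group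
`i`, and the `a`-th of them meets the constraint `j` if `sat j i a`. -/
noncomputable def good (j : ℕ) : Finset ℕ :=
  (Finset.range (g * h)).filter fun e => sat j (e / h) (e % h)

/-- The first `p` elements of the block `g + 1`, which no solution contains. -/
def padding (p : ℕ) : Finset ℕ := Finset.Ico ((g + 1) * h) ((g + 1) * h + p)

open Classical in
/-- The candidates of the group `c` for `c < g`, and otherwise the candidates that meet the
constraint `c - g`, padded to `h` elements; a slot `c - g` that carries no constraint gets `h - 1`
elements, so that nothing needs to be chosen from them. -/
noncomputable def part (c : ℕ) : Finset ℕ :=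
  if c < g then block h c
  else if valid (c - g) then
    good g h sat (c - g) ∪ padding g h (h - (good g h sat (c - g)).card)
  else padding g h (h - 1)

/-- The set system whose majorities encode the selection problem: each set consists of the block
`g`, which every solution contains, and a part from which one more element is needed. -/
noncomputable def system (c : ℕ) : Finset ℕ := block h g ∪ part g h valid sat c

end Definitions

variable {g h L : ℕ} {valid : ℕ → Prop} {sat : ℕ → ℕ → ℕ → Prop}

theorem mem_good {j e : ℕ} : e ∈ good g h sat j ↔ e < g * h ∧ sat j (e / h) (e % h) := by
  classical
  rw [good, Finset.mem_filter, Finset.mem_range]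

theorem block_subset_range {c : ℕ} (hc : c < g) : block h c ⊆ Finset.range (g * h) := fun _ he =>
  Finset.mem_range.2 ((Finset.mem_Ico.1 he).2.trans_le (Nat.mul_le_mul_right h hc))

theorem mul_add_mem_good_iff {i j a : ℕ} (hi : i < g) (ha : a < h) :
    i * h + a ∈ good g h sat j ↔ sat j i a := by
  have mem : i * h + a ∈ block h i := mul_add_mem_block ha
  have lt : i * h + a < g * h := Finset.mem_range.1 (block_subset_range hi mem)
  rw [mem_good, and_iff_right lt, (mem_block_iff ha.pos).1 mem, Nat.mul_add_mod',
    Nat.mod_eq_of_lt ha]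

theorem good_subset_range {j : ℕ} : good g h sat j ⊆ Finset.range (g * h) :=
  fun _ he => Finset.mem_range.2 (mem_good.1 he).1

theorem part_of_lt {c : ℕ} (hc : c < g) : part g h valid sat c = block h c := if_pos hc

theorem part_of_valid {j : ℕ} (hj : valid j) : part g h valid sat (g + j) =
    good g h sat j ∪ padding g h (h - (good g h sat j).card) := by
  rw [part, if_neg (Nat.le_add_right g j).not_gt, Nat.add_sub_cancel_left, if_pos hj]

theorem part_of_not_valid {j : ℕ} (hj : ¬ valid j) :
    part g h valid sat (g + j) = padding g h (h - 1) := by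
  rw [part, if_neg (Nat.le_add_right g j).not_gt, Nat.add_sub_cancel_left, if_neg hj]

theorem card_padding (g h p : ℕ) : (padding g h p).card = p := by
  rw [padding, Nat.card_Ico, Nat.add_sub_cancel_left]

theorem part_cases (g h : ℕ) (valid : ℕ → Prop) (sat : ℕ → ℕ → ℕ → Prop) (c : ℕ) :
    (c < g ∧ part g h valid sat c = block h c) ∨
    (∃ j, c = g + j ∧ valid j ∧
      part g h valid sat c = good g h sat j ∪ padding g h (h - (good g h sat j).card)) ∨
    (∃ j, c = g + j ∧ ¬ valid j ∧ part g h valid sat c = padding g h (h - 1)) := by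
  rcases Nat.lt_or_ge c g with hc | hc
  · exact Or.inl ⟨hc, part_of_lt hc⟩
  obtain ⟨j, rfl⟩ := Nat.exists_eq_add_of_le hc
  by_cases hj : valid j
  · exact Or.inr (Or.inl ⟨j, rfl, hj, part_of_valid hj⟩)
  · exact Or.inr (Or.inr ⟨j, rfl, hj, part_of_not_valid hj⟩)

theorem lt_or_mem_padding {c e : ℕ} (he : e ∈ part g h valid sat c) :
    e < g * h ∨ (g + 1) * h ≤ e := by
  rcases part_cases g h valid sat c with ⟨hc, eq⟩ | ⟨j, -, -, eq⟩ | ⟨j, -, -, eq⟩ <;> rw [eq] at he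
  · exact Or.inl (Finset.mem_range.1 (block_subset_range hc he))
  · exact (Finset.mem_union.1 he).imp (fun h => (mem_good.1 h).1) fun h => (Finset.mem_Ico.1 h).1
  · exact Or.inr (Finset.mem_Ico.1 he).1

theorem disjoint_block_part (c : ℕ) : Disjoint (block h g) (part g h valid sat c) := by
  rw [Finset.disjoint_left]
  intro e hcore hpart
  have core := Finset.mem_Ico.1 hcore
  have outside := lt_or_mem_padding hpart
  omega

theorem card_part_of_valid {j : ℕ} (hj : valid j) (hle : (good g h sat j).card ≤ h) :
    (part g h valid sat (g + j)).card = h := by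
  rw [part_of_valid hj, Finset.card_union_of_disjoint, card_padding]
  · omega
  · rw [Finset.disjoint_left]
    intro e hgood hpadding
    have lt := (mem_good.1 hgood).1
    have le := (Finset.mem_Ico.1 hpadding).1
    rw [Nat.succ_mul] at le
    omega

theorem card_part_of_not_valid {j : ℕ} (hj : ¬ valid j) :
    (part g h valid sat (g + j)).card = h - 1 := by
  rw [part_of_not_valid hj, card_padding]

theorem card_part_mem_Icc (hle : ∀ j, valid j → (good g h sat j).card ≤ h) (c : ℕ) :
    (part g h valid sat c).card ∈ Set.Icc (h - 1) h := by
  rcases part_cases g h valid sat c with ⟨-, eq⟩ | ⟨j, rfl, hj, -⟩ | ⟨j, rfl, hj, -⟩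
  · rw [eq, card_block]
    exact ⟨Nat.sub_le h 1, le_rfl⟩
  · rw [card_part_of_valid hj (hle j hj)]
    exact ⟨Nat.sub_le h 1, le_rfl⟩
  · rw [card_part_of_not_valid hj]
    exact ⟨le_rfl, Nat.sub_le h 1⟩

theorem lt_card_system (hgh : g + 2 ≤ h) (hle : ∀ j, valid j → (good g h sat j).card ≤ h) (c : ℕ) :
    h + g < (system g h valid sat c).card := by
  rw [system, Finset.card_union_of_disjoint (disjoint_block_part c), card_block]
  have le := (card_part_mem_Icc (valid := valid) (sat := sat) hle c).1
  omega

theorem system_subset (hgood : ∀ j, valid j → (good g h sat j).Nonempty) (c : ℕ) :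
    system g h valid sat c ⊆ Finset.range ((g + 1) * h + (h - 1)) := by
  have padding_subset : ∀ p ≤ h - 1, padding g h p ⊆ Finset.range ((g + 1) * h + (h - 1)) :=
    fun p hp e he =>
      Finset.mem_range.2 ((Finset.mem_Ico.1 he).2.trans_le (Nat.add_le_add_left hp _))
  have range_subset : ∀ c ≤ g + 1,
      Finset.range (c * h) ⊆ Finset.range ((g + 1) * h + (h - 1)) := fun c hc =>
    Finset.range_mono ((Nat.mul_le_mul_right h hc).trans (Nat.le_add_right _ _))
  refine Finset.union_subset ((block_subset_range g.lt_succ_self).trans (range_subset _ le_rfl)) ?_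
  rcases part_cases g h valid sat c with ⟨hc, eq⟩ | ⟨j, -, hj, eq⟩ | ⟨j, -, -, eq⟩ <;> rw [eq]
  · exact (block_subset_range hc).trans (range_subset g g.le_succ)
  · exact Finset.union_subset (good_subset_range.trans (range_subset g g.le_succ))
      (padding_subset _ (Nat.sub_le_sub_left (hgood j hj).card_pos h))
  · exact padding_subset _ le_rfl

theorem exists_mem_system (hg : 0 < g) (hL : ∃ j < L, ¬ valid j) {e : ℕ}
    (he : e < (g + 1) * h + (h - 1)) : ∃ c < g + L, e ∈ system g h valid sat c := by
  have hh : 0 < h := Nat.pos_of_ne_zero fun h0 => by simp [h0] at he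
  rcases lt_trichotomy (e / h) g with hlt | heq | hgt
  · refine ⟨e / h, by omega, Finset.mem_union_right _ ?_⟩
    rw [part_of_lt hlt, mem_block_iff hh]
  · exact ⟨0, by omega, Finset.mem_union_left _ ((mem_block_iff hh).2 heq)⟩
  · obtain ⟨j, hjL, hj⟩ := hL
    refine ⟨g + j, by omega, Finset.mem_union_right _ ?_⟩
    rw [part_of_not_valid hj]
    exact Finset.mem_Ico.2 ⟨(Nat.le_div_iff_mul_le hh).1 hgt, he⟩

section OfDominates

variable {S : Finset ℕ}

theorem inter_core_nonempty (hg : 0 < g) (hle : ∀ j, valid j → (good g h sat j).card ≤ h)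
    (hL : ∃ j < L, ¬ valid j) (hSE : S ⊆ Finset.range ((g + 1) * h + (h - 1))) (hS : S.Nonempty)
    (hdom : ∀ c < g + L, Dominates S (system g h valid sat c)) : (S ∩ block h g).Nonempty := by
  obtain ⟨e, he⟩ := hS
  obtain ⟨c, hc, hec⟩ := exists_mem_system (sat := sat) hg hL (Finset.mem_range.1 (hSE he))
  exact (hdom c hc).inter_left_nonempty (disjoint_block_part c)
    ((card_part_mem_Icc hle c).2.trans_eq (card_block h g).symm)
    ⟨e, Finset.mem_inter.2 ⟨he, hec⟩⟩

theorem add_card_part_lt {c : ℕ} (hcore : (S ∩ block h g).Nonempty)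
    (hdom : Dominates S (system g h valid sat c)) : h + (part g h valid sat c).card <
      2 * ((S ∩ block h g).card + (S ∩ part g h valid sat c).card) := by
  have lt := hdom.card_add_card_lt (disjoint_block_part c)
    (hcore.mono (Finset.inter_subset_inter_left Finset.subset_union_left))
  rwa [card_block] at lt

theorem subset_and_card_inter_block_eq_one (hg : 2 ≤ g) (hS : S.card ≤ h + g)
    (hcore : (S ∩ block h g).Nonempty)
    (hdom : ∀ c < g, Dominates S (system g h valid sat c)) :
    S ⊆ Finset.range ((g + 1) * h) ∧ ∀ i < g, (S ∩ block h i).card = 1 := by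
  have selection := subset_and_card_inter_eq_one (S := S) (A := block h g) (B := block h)
    (I := Finset.range g) (by rwa [Finset.card_range])
    (fun i hi => disjoint_block (Finset.mem_range.1 hi).ne') (fun i _ j _ => disjoint_block)
    (by rwa [card_block, Finset.card_range]) fun i hi => by
      rw [Finset.mem_range] at hi
      have lt := add_card_part_lt hcore (hdom i hi)
      rw [part_of_lt hi, card_block] at lt
      rw [card_block]
      omega
  refine ⟨selection.1.trans (Finset.union_subset (block_subset_range g.lt_succ_self) ?_),
    fun i hi => selection.2 i (Finset.mem_range.2 hi)⟩
  exact Finset.biUnion_subset.2 fun i hi =>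
    block_subset_range ((Finset.mem_range.1 hi).trans g.lt_succ_self)

theorem exists_choice_of_dominates (hg : 2 ≤ g)
    (hle : ∀ j, valid j → (good g h sat j).card ≤ h) (hL : ∃ j < L, ¬ valid j)
    (hSE : S ⊆ Finset.range ((g + 1) * h + (h - 1))) (hne : S.Nonempty) (hS : S.card ≤ h + g)
    (hdom : ∀ c < g + L, Dominates S (system g h valid sat c)) :
    ∃ a : ℕ → ℕ, (∀ i < g, a i < h) ∧ ∀ j < L, valid j → ∃ i < g, sat j i (a i) := by
  have hcore := inter_core_nonempty (by omega) hle hL hSE hne hdom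
  have core_le : (S ∩ block h g).card ≤ h :=
    (Finset.card_le_card Finset.inter_subset_right).trans_eq (card_block h g)
  have hh : 0 < h := hcore.card_pos.trans_le core_le
  obtain ⟨subset, card_eq_one⟩ := subset_and_card_inter_block_eq_one hg hS hcore
    fun c hc => hdom c (hc.trans_le (Nat.le_add_right g L))
  have chosen : ∀ i < g, ∃ b, S ∩ block h i = {b} := fun i hi =>
    Finset.card_eq_one.1 (card_eq_one i hi)
  choose! b hb using chosen
  refine ⟨fun i => b i % h, fun i _ => Nat.mod_lt _ hh, fun j hj hvalid => ?_⟩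
  obtain ⟨e, he⟩ : (S ∩ part g h valid sat (g + j)).Nonempty := by
    have lt := add_card_part_lt hcore (hdom (g + j) (Nat.add_lt_add_left hj g))
    rw [card_part_of_valid hvalid (hle j hvalid)] at lt
    exact Finset.card_pos.1 (by omega)
  rw [part_of_valid hvalid, Finset.mem_inter, Finset.mem_union] at he
  obtain ⟨heS, hgood | hpadding⟩ := he
  · obtain ⟨elt, esat⟩ := mem_good.1 hgood
    have hi : e / h < g := Nat.div_lt_of_lt_mul (elt.trans_eq (Nat.mul_comm g h))
    have eq : e = b (e / h) := by
      rw [← Finset.mem_singleton, ← hb _ hi]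
      exact Finset.mem_inter.2 ⟨heS, (mem_block_iff hh).2 rfl⟩
    exact ⟨e / h, hi, by
      dsimp only
      rwa [← eq]⟩
  · exact absurd (Finset.mem_Ico.1 hpadding).1 (Finset.mem_range.1 (subset heS)).not_ge

end OfDominates

section OfChoice

variable {a : ℕ → ℕ}

/-- The block `g` together with the chosen candidates. -/
def solution (g h : ℕ) (a : ℕ → ℕ) : Finset ℕ :=
  block h g ∪ (Finset.range g).image fun i => i * h + a i

theorem mul_add_mem_solution {i : ℕ} (hi : i < g) : i * h + a i ∈ solution g h a :=
  Finset.mem_union_right _ (Finset.mem_image_of_mem _ (Finset.mem_range.2 hi))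

theorem solution_subset (ha : ∀ i < g, a i < h) :
    solution g h a ⊆ Finset.range ((g + 1) * h) := by
  refine Finset.union_subset (block_subset_range g.lt_succ_self) fun e he => ?_
  obtain ⟨i, hi, rfl⟩ := Finset.mem_image.1 he
  rw [Finset.mem_range] at hi
  exact block_subset_range (hi.trans g.lt_succ_self) (mul_add_mem_block (ha i hi))

theorem card_solution_le : (solution g h a).card ≤ h + g := by
  refine (Finset.card_union_le _ _).trans ?_
  rw [card_block]
  exact Nat.add_le_add_left (Finset.card_image_le.trans_eq (Finset.card_range g)) h

theorem dominates_solution (hh : 0 < h) (hle : ∀ j, valid j → (good g h sat j).card ≤ h)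
    (ha : ∀ i < g, a i < h) (hsat : ∀ j < L, valid j → ∃ i < g, sat j i (a i)) {c : ℕ}
    (hc : c < g + L) : Dominates (solution g h a) (system g h valid sat c) := by
  refine dominates_union_of_subset (disjoint_block_part c) Finset.subset_union_left ?_
  rw [card_block]
  have le := (card_part_mem_Icc (valid := valid) (sat := sat) hle c).2
  have of_mem : ∀ i < g, i * h + a i ∈ part g h valid sat c →
      0 < (solution g h a ∩ part g h valid sat c).card := fun i hi hmem =>
    Finset.card_pos.2 ⟨_, Finset.mem_inter.2 ⟨mul_add_mem_solution hi, hmem⟩⟩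
  rcases part_cases g h valid sat c with ⟨hcg, eq⟩ | ⟨j, rfl, hj, eq⟩ | ⟨j, rfl, hj, -⟩
  · have pos := of_mem c hcg (eq ▸ mul_add_mem_block (ha c hcg))
    omega
  · obtain ⟨i, hi, hsi⟩ := hsat j (Nat.lt_of_add_lt_add_left hc) hj
    have pos := of_mem i hi
      (eq ▸ Finset.mem_union_left _ ((mul_add_mem_good_iff hi (ha i hi)).2 hsi))
    omega
  · rw [card_part_of_not_valid hj]
    omega

end OfChoice

theorem exists_dominates_iff (hg : 2 ≤ g) (hle : ∀ j, valid j → (good g h sat j).card ≤ h)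
    (hL : ∃ j < L, ¬ valid j) :
    (∃ S ⊆ Finset.range ((g + 1) * h + (h - 1)), S.Nonempty ∧ S.card ≤ h + g ∧
        ∀ c < g + L, Dominates S (system g h valid sat c)) ↔
      ∃ a : ℕ → ℕ, (∀ i < g, a i < h) ∧ ∀ j < L, valid j → ∃ i < g, sat j i (a i) := by
  constructor
  · rintro ⟨S, hSE, hne, hS, hdom⟩
    exact exists_choice_of_dominates hg hle hL hSE hne hS hdom
  · rintro ⟨a, ha, hsat⟩
    have hh : 0 < h := (Nat.zero_le _).trans_lt (ha 0 (by omega))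
    exact ⟨solution g h a,
      (solution_subset ha).trans (Finset.range_mono (Nat.le_add_right _ _)),
      ⟨_, mul_add_mem_solution (i := 0) (by omega)⟩, card_solution_le,
      fun c hc => dominates_solution hh hle ha hsat hc⟩

end Selection

/-! ### The instance constructed from a formula -/

/-- The number whose unary code starts at position `p` of `x`; it is found by counting the `1`s from
position `p` on until the count stalls. -/
def unaryAt (x : List Bool) (p : ℕ) : ℕ :=
  (fun m => m + (x.getD (p + m) false).toNat)^[x.length] 0

/-- The position in the code `x` of a formula at which the code of the `l`-th literal starts. -/
def litStart (x : List Bool) (l : ℕ) : ℕ :=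
  (fun p => p + unaryAt x (p + 1) + 2)^[l] (unaryAt x 0 + 1)

theorem litStart_zero (x : List Bool) : litStart x 0 = unaryAt x 0 + 1 := rfl

theorem litStart_succ (x : List Bool) (l : ℕ) :
    litStart x (l + 1) = litStart x l + unaryAt x (litStart x l + 1) + 2 :=
  Function.iterate_succ_apply' _ _ _

theorem litStart_mono (x : List Bool) : Monotone (litStart x) :=
  monotone_nat_of_le_succ fun l => by
    rw [litStart_succ, Nat.add_assoc]
    exact Nat.le_add_right _ _

namespace AllianceReduction

variable (x : List Bool)

/-- The number of variables of the formula encoded by `x`. -/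
def numVars : ℕ := unaryAt x 0

/-- The number of variables in a group. As the number of candidates in a group is about
`2 ^ width x`, hence about the square root of the number of variables, the solution size is
dominated by the number of groups. -/
def width : ℕ := Nat.log 4 (numVars x) + 1

/-- The number of groups; the group of a variable is its quotient by `width x`. -/
def groups : ℕ := numVars x / width x + 2

/-- The number of candidates in a group. The first `2 ^ width x` of them are the assignments of the
variables in the group; the others make room for `2 ^ width x` candidates per literal of a clause,
and make the sets of the system larger than the solution. -/
def size : ℕ := 3 * 2 ^ width x + groups x

/-- The assignment `a` of the group `i` makes the `l`-th literal true. -/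
def LitHolds (l i a : ℕ) : Prop :=
  unaryAt x (litStart x l + 1) / width x = i ∧
    a.testBit (unaryAt x (litStart x l + 1) % width x) = x.getD (litStart x l) false

/-- There is a `j`-th clause. -/
def Valid (j : ℕ) : Prop := litStart x (3 * j) < x.length

/-- The candidate `a` of the group `i` makes the `j`-th clause true. -/
def Sat (j i a : ℕ) : Prop :=
  a < 2 ^ width x ∧ ∃ l : Fin 3, LitHolds x (3 * j + l) i a

theorem two_le_groups : 2 ≤ groups x := Nat.le_add_left _ _

theorem width_pos : 0 < width x := Nat.succ_pos _

theorem groups_add_two_le_size : groups x + 2 ≤ size x := by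
  have pos := Nat.two_pow_pos (width x)
  unfold size
  omega

theorem two_pow_width_le_size : 2 ^ width x ≤ size x := by
  unfold size
  omega

/-- The instance of Offensive Alliance constructed from the code of a formula. -/
noncomputable def toInstance : OffensiveAllianceInstance where
  numVertices := (groups x + 1) * size x + (size x - 1) +
    (groups x + x.length) * (2 * (size x + groups x))
  graph := incidenceGraph _ _ _ (Selection.system (groups x) (size x) (Valid x) (Sat x))
  k := size x + groups x
  k_pos := by
    have le := two_le_groups x
    omega

theorem card_good_le (j : ℕ) :
    (Selection.good (groups x) (size x) (Sat x) j).card ≤ size x := by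
  have subset : Selection.good (groups x) (size x) (Sat x) j ⊆
      ((Finset.univ : Finset (Fin 3)) ×ˢ Finset.range (2 ^ width x)).image fun la =>
        unaryAt x (litStart x (3 * j + la.1) + 1) / width x * size x + la.2 := by
    intro e he
    obtain ⟨-, hlt, l, hgroup, -⟩ := Selection.mem_good.1 he
    refine Finset.mem_image.2 ⟨(l, e % size x),
      Finset.mem_product.2 ⟨Finset.mem_univ l, Finset.mem_range.2 hlt⟩, ?_⟩
    rw [hgroup]
    exact Nat.div_add_mod' e (size x)
  refine (Finset.card_le_card subset).trans (Finset.card_image_le.trans ?_)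
  rw [Finset.card_product, Finset.card_range, Finset.card_univ, Fintype.card_fin]
  exact Nat.le_add_right _ _

end AllianceReduction

section Parsing

variable {x rest : List Bool} {p l v : ℕ} {s : Bool}

theorem getD_add_of_drop {y : List Bool} (h : x.drop p = y) (i : ℕ) :
    x.getD (p + i) false = y.getD i false := by
  rw [← h, List.getD_eq_getElem?_getD, List.getD_eq_getElem?_getD, List.getElem?_drop]

theorem unaryCode_append_getD (v i : ℕ) (rest : List Bool) (hi : i ≤ v) :
    (unaryCode v ++ rest).getD i false = decide (i < v) := by
  rcases hi.lt_or_eq with hi | rfl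
  · simp [unaryCode, List.getD_eq_getElem?_getD, List.getElem?_append, hi]
  · simp [unaryCode, List.getD_eq_getElem?_getD]

theorem unaryAt_eq (h : x.drop p = unaryCode v ++ rest) : unaryAt x p = v := by
  have count : ∀ i, (fun m => m + (x.getD (p + m) false).toNat)^[i] 0 = min i v := by
    intro i
    induction i with
    | zero => rw [Function.iterate_zero_apply, Nat.zero_min]
    | succ i ih =>
      rw [Function.iterate_succ_apply', ih, getD_add_of_drop h,
        unaryCode_append_getD v _ rest (min_le_right i v)]
      rcases Nat.lt_or_ge i v with hi | hi
      · rw [Nat.min_eq_left hi.le, Nat.min_eq_left hi, decide_eq_true hi, Bool.toNat_true]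
      · rw [Nat.min_eq_right hi, Nat.min_eq_right (hi.trans i.le_succ),
          decide_eq_false (lt_irrefl v), Bool.toNat_false, Nat.add_zero]
  have length_le : v ≤ x.length := by
    have length_eq := congrArg List.length h
    simp only [unaryCode, List.length_drop, List.length_append, List.length_replicate] at length_eq
    omega
  rw [unaryAt, count, min_eq_right length_le]

theorem drop_of_drop_unaryCode (h : x.drop p = unaryCode v ++ rest) :
    x.drop (p + v + 1) = rest := by
  rw [Nat.add_assoc, ← List.drop_drop, h]
  exact List.drop_left' (by simp only [unaryCode, List.length_append, List.length_replicate,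
    List.length_singleton])

theorem literal_of_drop_litStart (h : x.drop (litStart x l) = s :: unaryCode v ++ rest) :
    unaryAt x (litStart x l + 1) = v ∧ x.getD (litStart x l) false = s ∧
      x.drop (litStart x (l + 1)) = rest := by
  have drop_sign : x.drop (litStart x l + 1) = unaryCode v ++ rest := by
    rw [← List.drop_drop, h]
    rfl
  have unary_eq := unaryAt_eq drop_sign
  refine ⟨unary_eq, getD_add_of_drop h 0, ?_⟩
  rw [litStart_succ, unary_eq, ← drop_of_drop_unaryCode drop_sign]
  congr 1
  omega

end Parsing

namespace ThreeCNF

/-- The part of `ThreeCNF.encode` that describes one clause. -/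
def clauseCode {n : ℕ} (c : Fin 3 → Fin n × Bool) : List Bool :=
  (List.finRange 3).flatMap fun i => (c i).2 :: unaryCode ((c i).1 : ℕ)

theorem clauseCode_append {n : ℕ} (c : Fin 3 → Fin n × Bool) (rest : List Bool) :
    clauseCode c ++ rest = (c 0).2 :: unaryCode ((c 0).1 : ℕ) ++
      ((c 1).2 :: unaryCode ((c 1).1 : ℕ) ++ ((c 2).2 :: unaryCode ((c 2).1 : ℕ) ++ rest)) := by
  simp [clauseCode, List.finRange_succ]

theorem length_le_length_flatMap_clauseCode {n : ℕ} (l : List (Fin 3 → Fin n × Bool)) :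
    l.length ≤ (l.flatMap clauseCode).length := by
  induction l with
  | nil => exact Nat.zero_le _
  | cons c l ih =>
    rw [List.flatMap_cons, clauseCode_append]
    simp only [List.length_append, List.length_cons]
    omega

variable (φ : ThreeCNF)

theorem unaryAt_encode_zero : unaryAt φ.encode 0 = φ.numVars :=
  unaryAt_eq (rest := φ.clauses.flatMap clauseCode) rfl

theorem drop_litStart (j : ℕ) :
    φ.encode.drop (litStart φ.encode (3 * j)) = (φ.clauses.drop j).flatMap clauseCode := by
  induction j with
  | zero =>
    rw [Nat.mul_zero, litStart_zero, unaryAt_encode_zero, List.drop_zero]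
    have drop_eq := drop_of_drop_unaryCode (x := φ.encode) (p := 0) (v := φ.numVars) rfl
    rwa [Nat.zero_add] at drop_eq
  | succ j ih =>
    rcases Nat.lt_or_ge j φ.clauses.length with hj | hj
    · rw [List.drop_eq_getElem_cons hj, List.flatMap_cons, clauseCode_append] at ih
      obtain ⟨-, -, ih⟩ := literal_of_drop_litStart ih
      obtain ⟨-, -, ih⟩ := literal_of_drop_litStart ih
      exact (literal_of_drop_litStart ih).2.2
    · rw [List.drop_eq_nil_of_le hj, List.flatMap_nil, List.drop_eq_nil_iff] at ih
      rw [List.drop_eq_nil_of_le (hj.trans j.le_succ), List.flatMap_nil, List.drop_eq_nil_iff]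
      exact ih.trans (litStart_mono _ (Nat.mul_le_mul_left 3 j.le_succ))

theorem valid_encode_iff {j : ℕ} :
    AllianceReduction.Valid φ.encode j ↔ j < φ.clauses.length := by
  rw [AllianceReduction.Valid, ← not_le, ← List.drop_eq_nil_iff, drop_litStart, ← not_le,
    ← List.drop_eq_nil_iff, not_iff_not]
  refine ⟨fun h => List.eq_nil_of_length_eq_zero ?_, fun h => by rw [h, List.flatMap_nil]⟩
  have le := length_le_length_flatMap_clauseCode (φ.clauses.drop j)
  rwa [h, List.length_nil, Nat.le_zero] at le

theorem literal_encode {j : ℕ} (hj : j < φ.clauses.length) (l : Fin 3) :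
    unaryAt φ.encode (litStart φ.encode (3 * j + l) + 1) = (φ.clauses[j] l).1 ∧
      φ.encode.getD (litStart φ.encode (3 * j + l)) false = (φ.clauses[j] l).2 := by
  have h := drop_litStart φ j
  rw [List.drop_eq_getElem_cons hj, List.flatMap_cons, clauseCode_append] at h
  obtain ⟨var₀, sign₀, h⟩ := literal_of_drop_litStart h
  obtain ⟨var₁, sign₁, h⟩ := literal_of_drop_litStart h
  obtain ⟨var₂, sign₂, -⟩ := literal_of_drop_litStart h
  fin_cases l
  exacts [⟨var₀, sign₀⟩, ⟨var₁, sign₁⟩, ⟨var₂, sign₂⟩]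

theorem clauses_length_lt : φ.clauses.length < φ.encode.length := by
  have length_eq : φ.encode.length = φ.numVars + 1 + (φ.clauses.flatMap clauseCode).length := by
    change (unaryCode φ.numVars ++ φ.clauses.flatMap clauseCode).length = _
    simp only [unaryCode, List.length_append, List.length_replicate, List.length_singleton]
  have le := length_le_length_flatMap_clauseCode φ.clauses
  omega

end ThreeCNF

namespace AllianceReduction

variable (φ : ThreeCNF)

theorem sat_encode_iff {j : ℕ} (hj : j < φ.clauses.length) {i a : ℕ} :
    Sat φ.encode j i a ↔ a < 2 ^ width φ.encode ∧ ∃ l : Fin 3,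
      ((φ.clauses[j] l).1 : ℕ) / width φ.encode = i ∧
        a.testBit ((φ.clauses[j] l).1 % width φ.encode) = (φ.clauses[j] l).2 := by
  simp only [Sat, LitHolds, (φ.literal_encode hj _).1, (φ.literal_encode hj _).2]

theorem div_width_lt_groups (v : Fin φ.numVars) : (v : ℕ) / width φ.encode < groups φ.encode := by
  rw [groups, numVars, φ.unaryAt_encode_zero]
  exact (Nat.div_le_div_right v.2.le).trans_lt (by omega)

theorem good_nonempty {j : ℕ} (hj : j < φ.clauses.length) :
    (Selection.good (groups φ.encode) (size φ.encode) (Sat φ.encode) j).Nonempty := by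
  obtain ⟨⟨v, s⟩, hc⟩ : ∃ literal, φ.clauses[j] 0 = literal := ⟨_, rfl⟩
  refine ⟨v / width φ.encode * size φ.encode + Nat.ofBits fun _ : Fin (width φ.encode) => s,
    (Selection.mul_add_mem_good_iff (div_width_lt_groups φ v)
      ((Nat.ofBits_lt_two_pow _).trans_le (two_pow_width_le_size _))).2
    ((sat_encode_iff φ hj).2 ⟨Nat.ofBits_lt_two_pow _, 0, ?_, ?_⟩)⟩
  · rw [hc]
  · rw [hc, Nat.testBit_ofBits_lt _ _ (Nat.mod_lt _ (width_pos _))]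

theorem satisfiable_of_choice {a : ℕ → ℕ} (ha : ∀ j < φ.encode.length, Valid φ.encode j →
    ∃ i < groups φ.encode, Sat φ.encode j i (a i)) : φ.Satisfiable := by
  refine ⟨fun v => (a (v / width φ.encode)).testBit (v % width φ.encode), fun c hc => ?_⟩
  obtain ⟨j, hj, rfl⟩ := List.getElem_of_mem hc
  obtain ⟨i, -, hi⟩ := ha j (hj.trans φ.clauses_length_lt) (φ.valid_encode_iff.2 hj)
  obtain ⟨-, l, hgroup, hbit⟩ := (sat_encode_iff φ hj).1 hi
  rw [← hgroup] at hbit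
  exact ⟨l, hbit⟩

theorem exists_choice_of_satisfiable (hφ : φ.Satisfiable) :
    ∃ a : ℕ → ℕ, (∀ i < groups φ.encode, a i < size φ.encode) ∧
      ∀ j < φ.encode.length, Valid φ.encode j → ∃ i < groups φ.encode,
        Sat φ.encode j i (a i) := by
  obtain ⟨α, hα⟩ := hφ
  let value : ℕ → Bool := fun v => if hv : v < φ.numVars then α ⟨v, hv⟩ else false
  have value_eq (v : Fin φ.numVars) : value v = α v := dif_pos v.2
  refine ⟨fun i => Nat.ofBits fun t : Fin (width φ.encode) => value (i * width φ.encode + t),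
    fun i _ => (Nat.ofBits_lt_two_pow _).trans_le (two_pow_width_le_size _), fun j _ hj => ?_⟩
  rw [φ.valid_encode_iff] at hj
  obtain ⟨l, hl⟩ := hα _ (List.getElem_mem hj)
  refine ⟨_, div_width_lt_groups φ (φ.clauses[j] l).1,
    (sat_encode_iff φ hj).2 ⟨Nat.ofBits_lt_two_pow _, l, rfl, ?_⟩⟩
  rw [Nat.testBit_ofBits_lt _ _ (Nat.mod_lt _ (width_pos _))]
  simp only [Nat.div_add_mod', value_eq, hl]

theorem toInstance_isYes_iff : (toInstance φ.encode).IsYes ↔ φ.Satisfiable := by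
  have exists_not_valid : ∃ j < φ.encode.length, ¬ Valid φ.encode j :=
    ⟨φ.clauses.length, φ.clauses_length_lt, fun h => (φ.valid_encode_iff.1 h).false⟩
  have majorities := incidenceGraph.exists_isOffensiveAlliance_iff
    (Selection.system_subset fun j hj => good_nonempty φ (φ.valid_encode_iff.1 hj))
    (toInstance φ.encode).k_pos le_rfl fun c (_ : c < groups φ.encode + φ.encode.length) =>
      Selection.lt_card_system (groups_add_two_le_size _) (fun j _ => card_good_le _ j) c
  have selections := Selection.exists_dominates_iff (two_le_groups φ.encode)
    (fun j _ => card_good_le _ j) exists_not_valid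
  exact (majorities.trans selections).trans
    ⟨fun ⟨_, _, ha⟩ => satisfiable_of_choice φ ha, exists_choice_of_satisfiable φ⟩

end AllianceReduction

/-! ### The reduction is computed in polynomial time -/

theorem iterate_add_toNat_le (b : ℕ → Bool) (i : ℕ) : (fun m => m + (b m).toNat)^[i] 0 ≤ i := by
  induction i with
  | zero => exact le_rfl
  | succ i ih =>
    rw [Function.iterate_succ_apply']
    exact Nat.add_le_add ih (Bool.toNat_le _)

theorem unaryAt_le (x : List Bool) (p : ℕ) : unaryAt x p ≤ x.length :=
  iterate_add_toNat_le (fun m => x.getD (p + m) false) x.length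

theorem litStart_le (x : List Bool) (l : ℕ) : litStart x l ≤ (l + 1) * (x.length + 2) := by
  induction l with
  | zero =>
    have le := unaryAt_le x 0
    rw [litStart_zero]
    omega
  | succ l ih =>
    have le := unaryAt_le x (litStart x l + 1)
    rw [litStart_succ, Nat.succ_mul]
    omega

theorem flatMap_range_eq_flatMap_finRange (m : ℕ) (f : ℕ → List Bool) :
    (List.range m).flatMap f = (List.finRange m).flatMap fun u : Fin m => f u := by
  rw [← List.map_coe_finRange_eq_range, List.flatMap_map]

namespace AllianceReduction

open PolyFn (const)

variable {n : ℕ} {F G H : List Bool → (Fin n → ℕ) → ℕ}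

theorem polyFn_unaryAt (hF : PolyFn F) : PolyFn fun x ρ => unaryAt x (F x ρ) :=
  (const 0).iterate ((PolyFn.proj 0).add (hF.weaken.add (PolyFn.proj 0)).getD) PolyFn.length
    Polynomial.X fun x ρ B hx _ i hi => by
      rw [Polynomial.eval_X]
      exact (iterate_add_toNat_le (fun m => x.getD (F x ρ + m) false) i).trans (hi.trans hx)

theorem polyFn_litStart (hF : PolyFn F) : PolyFn fun x ρ => litStart x (F x ρ) := by
  obtain ⟨c, hc⟩ := hF.exists_bound
  refine ((polyFn_unaryAt (const 0)).add (const 1)).iterate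
    (((PolyFn.proj 0).add (polyFn_unaryAt ((PolyFn.proj 0).add (const 1)))).add (const 2)) hF
    ((c + 1) * (Polynomial.X + 2)) fun x ρ B hx hρ i hi => ?_
  simp only [Polynomial.eval_mul, Polynomial.eval_add, Polynomial.eval_X, Polynomial.eval_one,
    Polynomial.eval_ofNat]
  exact (litStart_le x i).trans (Nat.mul_le_mul
    (Nat.succ_le_succ (hi.trans (hc x ρ B hx hρ))) (Nat.add_le_add_right hx 2))

theorem polyFn_numVars : PolyFn fun x (_ : Fin n → ℕ) => numVars x :=
  polyFn_unaryAt (const 0)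

theorem polyFn_width : PolyFn fun x (_ : Fin n → ℕ) => width x :=
  (polyFn_numVars.log (by norm_num)).add (const 1)

theorem polyFn_groups : PolyFn fun x (_ : Fin n → ℕ) => groups x :=
  (polyFn_numVars.div polyFn_width).add (const 2)

theorem two_pow_width_sq_le (x : List Bool) : (2 ^ width x) ^ 2 ≤ 4 * (numVars x + 1) := by
  rw [← pow_mul, Nat.mul_comm, pow_mul, width, pow_succ, Nat.mul_comm]
  refine Nat.mul_le_mul_left 4 ?_
  rcases (numVars x).eq_zero_or_pos with h | h
  · rw [h, Nat.log_zero_right, pow_zero, Nat.zero_add]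
  · exact (Nat.pow_log_le_self 4 h.ne').trans (Nat.le_succ _)

theorem polyFn_two_pow_width : PolyFn fun x (_ : Fin n → ℕ) => 2 ^ width x :=
  polyFn_width.two_pow ((const 4).mul (polyFn_numVars.add (const 1))) fun x _ =>
    (Nat.le_self_pow two_ne_zero _).trans (two_pow_width_sq_le x)

theorem polyFn_size : PolyFn fun x (_ : Fin n → ℕ) => size x :=
  ((const 3).mul polyFn_two_pow_width).add polyFn_groups

theorem polyPred_litHolds (hF : PolyFn F) (hG : PolyFn G) (hH : PolyFn H) :
    PolyPred fun x ρ => LitHolds x (F x ρ) (G x ρ) (H x ρ) := by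
  have start := polyFn_litStart hF
  have var := polyFn_unaryAt (start.add (const 1))
  exact (((var.div polyFn_width).eq hG).and
    ((hH.toNat_testBit (var.mod polyFn_width)).eq start.getD)).of_iff fun _ _ =>
      and_congr_right' ⟨fun h => by simpa using congrArg (· == 1) h, congrArg Bool.toNat⟩

theorem polyPred_valid (hF : PolyFn F) : PolyPred fun x ρ => Valid x (F x ρ) :=
  (polyFn_litStart ((const 3).mul hF)).lt PolyFn.length

theorem polyPred_sat (hF : PolyFn F) (hG : PolyFn G) (hH : PolyFn H) :
    PolyPred fun x ρ => Sat x (F x ρ) (G x ρ) (H x ρ) := by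
  have holds : ∀ l : ℕ, PolyPred fun x ρ => LitHolds x (3 * F x ρ + l) (G x ρ) (H x ρ) := fun l =>
    polyPred_litHolds (((const 3).mul hF).add (const l)) hG hH
  refine ((hH.lt polyFn_two_pow_width).and ((holds 0).or ((holds 1).or (holds 2)))).of_iff
    fun x ρ => ?_
  rw [Sat, Fin.exists_fin_succ, Fin.exists_fin_two]
  rfl

theorem polyPred_mem_good (hF : PolyFn F) (hG : PolyFn G) : PolyPred fun x ρ =>
    F x ρ ∈ Selection.good (groups x) (size x) (Sat x) (G x ρ) :=
  ((hF.lt (polyFn_groups.mul polyFn_size)).and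
    (polyPred_sat hG (hF.div polyFn_size) (hF.mod polyFn_size))).of_iff
      fun _ _ => Selection.mem_good.symm

theorem polyFn_card_good (hF : PolyFn F) : PolyFn fun x ρ =>
    (Selection.good (groups x) (size x) (Sat x) (F x ρ)).card := by
  classical
  refine ((polyFn_groups.mul polyFn_size).card_filter_range
    (polyPred_mem_good (PolyFn.proj 0) hF.weaken)).of_eq fun x ρ => ?_
  congr 1
  ext e
  simp only [Finset.mem_filter, Fin.cons_zero, Fin.tail_cons]
  exact and_iff_right_of_imp fun he => Selection.good_subset_range he

theorem polyPred_mem_block (hF : PolyFn F) (hG : PolyFn G) (hH : PolyFn H) :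
    PolyPred fun x ρ => F x ρ ∈ block (G x ρ) (H x ρ) :=
  (((hH.mul hG).le hF).and (hF.lt ((hH.add (const 1)).mul hG))).of_iff
    fun _ _ => Finset.mem_Ico.symm

theorem polyPred_mem_padding (hF : PolyFn F) (hG : PolyFn G) : PolyPred fun x ρ =>
    F x ρ ∈ Selection.padding (groups x) (size x) (G x ρ) := by
  have start := (polyFn_groups.add (const 1)).mul (polyFn_size (n := n))
  exact ((start.le hF).and (hF.lt (start.add hG))).of_iff fun _ _ => Finset.mem_Ico.symm

theorem polyPred_mem_part (hF : PolyFn F) (hG : PolyFn G) : PolyPred fun x ρ =>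
    F x ρ ∈ Selection.part (groups x) (size x) (Valid x) (Sat x) (G x ρ) := by
  have slot := hG.sub polyFn_groups
  have isGroup := hG.lt polyFn_groups
  refine ((isGroup.and (polyPred_mem_block hF polyFn_size hG)).or
    (isGroup.not.and (((polyPred_valid slot).and ((polyPred_mem_good hF slot).or
      (polyPred_mem_padding hF (polyFn_size.sub (polyFn_card_good slot))))).or
    ((polyPred_valid slot).not.and
      (polyPred_mem_padding hF (polyFn_size.sub (const 1))))))).of_iff fun x ρ => ?_
  unfold Selection.part
  split_ifs <;> simp only [*, Finset.mem_union] <;> tauto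

theorem polyPred_mem_system (hF : PolyFn F) (hG : PolyFn G) : PolyPred fun x ρ =>
    F x ρ ∈ Selection.system (groups x) (size x) (Valid x) (Sat x) (G x ρ) :=
  ((polyPred_mem_block hF polyFn_size polyFn_groups).or (polyPred_mem_part hF hG)).of_iff
    fun _ _ => Finset.mem_union.symm

theorem polyWord_unaryCode (hF : PolyFn F) : PolyWord fun x ρ => unaryCode (F x ρ) :=
  PolyWord.append hF (PolyWord.bit false)

theorem polyWord_encode_toInstance :
    PolyWord fun x (_ : Fin 0 → ℕ) => (toInstance x).encode := by
  classical
  have elements : ∀ {n}, PolyFn fun x (_ : Fin n → ℕ) =>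
      (groups x + 1) * size x + (size x - 1) :=
    ((polyFn_groups.add (const 1)).mul polyFn_size).add (polyFn_size.sub (const 1))
  have param : ∀ {n}, PolyFn fun x (_ : Fin n → ℕ) => size x + groups x :=
    polyFn_size.add polyFn_groups
  have copies : ∀ {n}, PolyFn fun x (_ : Fin n → ℕ) => 2 * (size x + groups x) :=
    (const 2).mul param
  have vertices : ∀ {n}, PolyFn fun x (_ : Fin n → ℕ) => (toInstance x).numVertices :=
    elements.add ((polyFn_groups.add PolyFn.length).mul copies)
  have incident := fun u v : Fin 2 =>
    ((PolyFn.proj u).lt elements).and ((elements.le (PolyFn.proj v)).and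
      (polyPred_mem_system (PolyFn.proj u) (((PolyFn.proj v).sub elements).div copies)))
  have adjacent := ((incident 1 0).or (incident 0 1)).decide
  refine (((polyWord_unaryCode vertices).append (polyWord_unaryCode param)).append
    (PolyWord.flatMap_range vertices (PolyWord.flatMap_range vertices adjacent))).of_eq
      fun x ρ => ?_
  rw [OffensiveAllianceInstance.encode]
  congr 1
  simp only [flatMap_range_eq_flatMap_finRange, List.map_eq_flatMap]
  rfl

end AllianceReduction

/-! ### The parameter of the constructed instance -/

namespace AllianceReduction

variable (x : List Bool)

theorem toInstance_k_eq : (toInstance x).k = 3 * 2 ^ width x + 2 * groups x := by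
  change size x + groups x = _
  rw [size]
  omega

theorem toInstance_k_le : (toInstance x).k ≤ 2 ^ (2 * width x + 4) := by
  have two_le : 2 ≤ 2 ^ width x := Nat.pow_le_pow_right two_pos (width_pos x)
  have numVars_lt : numVars x < (2 ^ width x) ^ 2 := by
    rw [← pow_mul, Nat.mul_comm, pow_mul]
    exact Nat.lt_pow_succ_log_self (by norm_num) _
  have groups_le : groups x ≤ numVars x + 2 := Nat.add_le_add_right (Nat.div_le_self _ _) 2
  calc (toInstance x).k = 3 * 2 ^ width x + 2 * groups x := toInstance_k_eq x
    _ ≤ (2 ^ width x) ^ 2 * 2 ^ 4 := by nlinarith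
    _ = 2 ^ (2 * width x + 4) := by rw [pow_add, Nat.mul_comm 2, pow_mul]

theorem log_toInstance_k_le : Real.log (toInstance x).k ≤ 6 * (width x : ℝ) := by
  have exponent_le : 2 * width x + 4 ≤ 6 * width x := by
    have pos := width_pos x
    omega
  calc Real.log (toInstance x).k ≤ Real.log ((2 : ℝ) ^ (2 * width x + 4)) :=
        Real.log_le_log (Nat.cast_pos.2 (toInstance x).k_pos) (mod_cast toInstance_k_le x)
    _ = (2 * width x + 4 : ℕ) * Real.log 2 := Real.log_pow _ _
    _ ≤ (2 * width x + 4 : ℕ) :=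
        mul_le_of_le_one_right (Nat.cast_nonneg _) (Real.log_two_lt_d9.le.trans (by norm_num))
    _ ≤ 6 * (width x : ℝ) := mod_cast exponent_le

theorem toInstance_k_mul_width_le : (toInstance x).k * width x ≤ 30 * (numVars x + 1) := by
  have width_le : width x ≤ 2 ^ width x := Nat.lt_two_pow_self.le
  have groups_mul_le : groups x * width x ≤ numVars x + 2 * width x := by
    rw [groups, Nat.add_mul]
    exact Nat.add_le_add_right (Nat.div_mul_le_self _ _) _
  have sq_le := two_pow_width_sq_le x
  rw [toInstance_k_eq]
  nlinarith

theorem toInstance_k_mul_log_le :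
    ((toInstance x).k : ℝ) * Real.log (toInstance x).k ≤ 180 * ((numVars x : ℝ) + 1) := by
  have mul_width_le : ((toInstance x).k : ℝ) * width x ≤ 30 * (numVars x + 1) :=
    mod_cast toInstance_k_mul_width_le x
  calc ((toInstance x).k : ℝ) * Real.log (toInstance x).k
      ≤ (toInstance x).k * (6 * (width x : ℝ)) :=
        mul_le_mul_of_nonneg_left (log_toInstance_k_le x) (Nat.cast_nonneg _)
    _ ≤ 180 * ((numVars x : ℝ) + 1) := by linarith

end AllianceReduction

theorem exists_le_add_mul_of_isLittleO {f g : ℕ → ℝ} (hfg : Asymptotics.IsLittleO Filter.atTop f g)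
    (hg : ∀ k, 0 ≤ g k) {ε : ℝ} (hε : 0 < ε) : ∃ M : ℝ, ∀ k, f k ≤ M + ε * g k := by
  obtain ⟨K, hK⟩ := Filter.eventually_atTop.1 (hfg.def hε)
  have sum_nonneg : 0 ≤ ∑ k ∈ Finset.range K, |f k| := Finset.sum_nonneg fun _ _ => abs_nonneg _
  refine ⟨∑ k ∈ Finset.range K, |f k|, fun k => (le_abs_self (f k)).trans ?_⟩
  rcases Nat.lt_or_ge k K with hk | hk
  · exact (Finset.single_le_sum (f := fun k => |f k|) (fun _ _ => abs_nonneg _)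
      (Finset.mem_range.2 hk)).trans (le_add_of_nonneg_right (mul_nonneg hε.le (hg k)))
  · have le := hK k hk
    rw [Real.norm_eq_abs, Real.norm_of_nonneg (hg k)] at le
    exact le.trans (le_add_of_nonneg_left sum_nonneg)

theorem AllianceReduction.exists_two_rpow_le {f : ℕ → ℝ}
    (hf : Asymptotics.IsLittleO Filter.atTop f fun k : ℕ => (k : ℝ) * Real.log k)
    {δ : ℝ} (hδ : 0 < δ) : ∃ C : ℕ, ∀ x : List Bool,
      (2 : ℝ) ^ f (toInstance x).k ≤ C * (2 : ℝ) ^ (δ * (numVars x : ℝ)) := by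
  obtain ⟨M, hM⟩ := exists_le_add_mul_of_isLittleO hf
    (fun k => mul_nonneg k.cast_nonneg (Real.log_natCast_nonneg k)) (ε := δ / 180) (by positivity)
  obtain ⟨C, hC⟩ := exists_nat_ge ((2 : ℝ) ^ (M + δ))
  refine ⟨C, fun x => ?_⟩
  have exponent_le : f (toInstance x).k ≤ (M + δ) + δ * numVars x :=
    calc f (toInstance x).k
        ≤ M + δ / 180 * ((toInstance x).k * Real.log (toInstance x).k) := hM _
      _ ≤ M + δ / 180 * (180 * (numVars x + 1)) := by
        gcongr M + δ / 180 * ?_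
        exact toInstance_k_mul_log_le x
      _ = (M + δ) + δ * numVars x := by ring
  calc (2 : ℝ) ^ f (toInstance x).k ≤ 2 ^ ((M + δ) + δ * numVars x) :=
        Real.rpow_le_rpow_of_exponent_le one_le_two exponent_le
    _ = 2 ^ (M + δ) * 2 ^ (δ * (numVars x : ℝ)) := Real.rpow_add two_pos _ _
    _ ≤ C * 2 ^ (δ * (numVars x : ℝ)) := by gcongr

theorem mainTheorem3 (eth : ExponentialTimeHypothesis) :
    ¬ ∃ f : ℕ → ℝ,
      Asymptotics.IsLittleO Filter.atTop f (fun k : ℕ => (k : ℝ) * Real.log (k : ℝ)) ∧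
      SolvableInOStar OffensiveAllianceInstance.encode OffensiveAllianceInstance.IsYes
        (fun I => (2 : ℝ) ^ f I.k) := by
  rintro ⟨f, hf, solvable⟩
  obtain ⟨δ, hδ, not_solvable⟩ := eth
  obtain ⟨C, hC⟩ := AllianceReduction.exists_two_rpow_le hf hδ
  refine not_solvable (solvable.of_reduction AllianceReduction.polyWord_encode_toInstance
    (fun φ => AllianceReduction.toInstance φ.encode) (fun _ _ => rfl)
    AllianceReduction.toInstance_isYes_iff
    (fun φ => Real.one_le_rpow one_le_two (by positivity)) (C := C) fun φ => ?_)
  have bound := hC φ.encode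
  rwa [AllianceReduction.numVars, φ.unaryAt_encode_zero] at bound
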